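/- **Theorem (learning cost of the shadow kernel, general case).** *Setting.* Let $G$ be a $D$-dimensional rectangular (hypercubic) lattice with periodic boundary condition and $n=|G|$ sites, with one qubit per site and $\mathrm{dist}$ the $\ell^1$ lattice distance. A state $\rho$ of the $n$ qubits has correlation length at most $\xi>0$ if $$\bigl|\mathrm{tr}(O_AO_B\rho)-\mathrm{tr}(O_A\rho)\,\mathrm{tr}(O_B\rho)\bigr|\le \|O_A\|_S\,\|O_B\|_S\,e^{-\mathrm{dist}(A,B)/\xi}$$ for all observables $O_A,O_B$ acting on subsystems $A,B\subseteq G$, where $\|\cdot\|_S$ is the spectral norm. An $m$-body, degree-$p$ polynomial is a finite sum $g(\rho)=\sum_i c_i\prod_{j=1}^p \mathrm{tr}(P_{ij}\rho)$ with $c_i\in\mathbb R$ and Pauli strings $P_{ij}$ of weight at most $m$; put $\|g\|_1=\sum_i|c_i|$. A classical shadow $S_T(\rho)$ of size $T$ is the record of $T$ independent rounds; in each round every qubit $i$ of a fresh copy of $\rho$ is measured in an independent, uniformly random basis $W_i^{(t)}\in\{X,Y,Z\}$ with outcome $o_i^{(t)}=\pm1$. Put $\sigma_i^{(t)}=\tfrac12(3o_i^{(t)}W_i^{(t)}+I)$.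 For $\tau,\gamma>0$ the shadow kernel is $$k_{\rm SK}(S_T(\rho),S_T(\tilde\rho))=\exp\Bigl[\tfrac{\tau}{T^2}\sum_{t,t'=1}^T\exp\Bigl(\tfrac{\gamma}{n}\sum_{i=1}^n\mathrm{tr}\bigl(\sigma_i^{(t)}\tilde\sigma_i^{(t')}\bigr)\Bigr)\Bigr].$$ Its feature vector $\phi_{\rm SK}$, with $\langle\phi_{\rm SK}(S),\phi_{\rm SK}(S')\rangle=k_{\rm SK}(S,S')$, is $$\phi_{\rm SK}(S_T(\rho))=\bigoplus_{d\ge0}\sqrt{\tfrac{\tau^d}{d!}}\Bigl(\bigoplus_{r\ge0}\sqrt{\tfrac1{r!}\bigl(\tfrac\gamma n\bigr)^r}\bigoplus_{i_1,\dots,i_r=1}^n\mathrm{vec}\,\sigma_{i_1\cdots i_r}\Bigr)^{\otimes d},\qquad \sigma_{i_1\cdots i_r}=\tfrac1T\sum_{t=1}^T\sigma_{i_1}^{(t)}\otimes\cdots\otimes\sigma_{i_r}^{(t)},$$ where $\mathrm{vec}\,\sigma_{i_1\cdots i_r}$ has the components $\mathrm{tr}(P\sigma_{i_1\cdots i_r})/\sqrt{2^r}$,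 $P\in\{I,X,Y,Z\}^{\otimes r}$. *Learning problem.* Let $\mathcal D$ be a probability distribution on $n$-qubit states such that $\rho\sim\mathcal D$ almost surely has correlation length at most $\xi$, and let $\mathcal D_S$ be the law of $(S_T(\rho),g(\rho))$ for $\rho\sim\mathcal D$. For data $Z=(x_i,y_i)_{i=1}^N$ put $L_Z(w)=\frac1N\sum_i\frac12(y_i-\langle w,\phi_{\rm SK}(x_i)\rangle)^2$ and $L_{\mathcal D_S}(w)=\mathbb E_{(x,y)\sim\mathcal D_S}\bigl[\frac12(y-\langle w,\phi_{\rm SK}(x)\rangle)^2\bigr]$. Kernel ridge regression with parameters $\lambda,B^2$ outputs $w_Z^*=\mathrm{argmin}_{\|w\|^2\le B^2}\bigl(L_Z(w)+\lambda\|w\|^2\bigr)$. *Statement.* Let $g$ be an $m$-body, degree-$p$ polynomial, let $\epsilon\in(0,\|g\|_1)$, and suppose that $2n/\gamma\ge1$ and $mp/\tau\ge1$. Let $N,T$ be natural numbers with $$N\ge\frac{600}{\epsilon^4}\|g\|_1^4\exp(\tau\exp(5\gamma))\Bigl(\frac{2m^2p^2}{\tau\gamma}\Bigr)^{mp}n^{mp},$$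 $$T\ge\frac{256}{3\epsilon^2}\|g\|_1^2\,12^m(mp)^2\log\Bigl[\frac{\|g\|_1^2\,2^{m+5}\,mp\,(3^{m^2p}+1)^2}{\epsilon^2}\Bigr],$$ and set $B^2=\|g\|_1^2\,(2m^2p^2/\tau\gamma)^{mp}\,n^{mp}$ and $\lambda=\epsilon^2/6B^2$. Then the losses are integrable, the minimiser $w_Z^*$ exists and is unique for every data set $Z$ of size $N$, and $$\mathop{\mathbb E}_{Z\sim\mathcal D_S^N}\bigl[L_{\mathcal D_S}(w_Z^*)\bigr]\le\epsilon^2 .$$ In particular $N=O(n^{mp}/\epsilon^4)$ shadows of size $T=\tilde O(1/\epsilon^2)$ suffice, for fixed $m,p,\tau,\gamma,\|g\|_1$. -/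

import Mathlib

open MeasureTheory

noncomputable section

open scoped ComplexOrder

set_option linter.unusedSectionVars false

namespace QShadow

/-! ## Qubits, Pauli strings and quantum states -/

section Qubits

variable {κ : Type*} [Fintype κ] [DecidableEq κ]

/-- The single-qubit Pauli matrices, in the order `I, X, Y, Z`. -/
def pauli : Fin 4 → Matrix (Fin 2) (Fin 2) ℂ :=
  ![1, !![0, 1; 1, 0], !![0, -Complex.I; Complex.I, 0], !![1, 0; 0, -1]]

/-- The tensor product of the `2 × 2` matrices `M k`, `k : κ`, as a matrix indexed by the
computational basis states `κ → Fin 2` of the qubits in `κ`. -/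
def tensor (M : κ → Matrix (Fin 2) (Fin 2) ℂ) : Matrix (κ → Fin 2) (κ → Fin 2) ℂ :=
  Matrix.of fun a b => ∏ k, M k (a k) (b k)

/-- The Pauli string with letter `P k` on the qubit `k`. -/
def pauliString (P : κ → Fin 4) : Matrix (κ → Fin 2) (κ → Fin 2) ℂ :=
  tensor fun k => pauli (P k)

/-- The Pauli weight: the number of qubits on which the string acts nontrivially. -/
def pauliWeight (P : κ → Fin 4) : ℕ := (Finset.univ.filter fun k => P k ≠ 0).card

variable (κ) in
/-- Quantum states (density matrices) of the qubits in `κ`. -/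
structure QState where
  /-- the density matrix -/
  mat : Matrix (κ → Fin 2) (κ → Fin 2) ℂ
  posSemidef : mat.PosSemidef
  trace_eq_one : mat.trace = 1

/-- The Borel structure on density matrices, generated by the matrix entries. -/
instance : MeasurableSpace (QState κ) :=
  MeasurableSpace.comap (fun ρ : QState κ => fun a b => ρ.mat a b)
    (inferInstance : MeasurableSpace ((κ → Fin 2) → (κ → Fin 2) → ℂ))

/-- The expectation value `tr (O ρ)`. -/
def QState.expect (ρ : QState κ) (O : Matrix (κ → Fin 2) (κ → Fin 2) ℂ) : ℂ :=
  (O * ρ.mat).trace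

/-! ## The exponential clustering property -/

/-- The operator `M ⊗ 1` on all qubits, for an operator `M` on the qubits in `A`. -/
def extendOp (A : Finset κ) (M : Matrix (A → Fin 2) (A → Fin 2) ℂ) :
    Matrix (κ → Fin 2) (κ → Fin 2) ℂ :=
  Matrix.of fun a b =>
    if ∀ k, k ∉ A → a k = b k then M (fun k => a k) (fun k => b k) else 0

/-- `O` is an observable acting on the subsystem `A`. -/
def IsObservableOn (A : Finset κ) (O : Matrix (κ → Fin 2) (κ → Fin 2) ℂ) : Prop :=
  ∃ M : Matrix (A → Fin 2) (A → Fin 2) ℂ, M.IsHermitian ∧ O = extendOp A M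

/-- The spectral norm of a matrix. -/
def specNorm (O : Matrix (κ → Fin 2) (κ → Fin 2) ℂ) : ℝ :=
  ‖Matrix.toEuclideanCLM (𝕜 := ℂ) O‖

/-- The smallest distance between a point of `A` and a point of `B`. (Its value for empty `A` or
`B` is irrelevant below: an operator acting on no qubit is a multiple of the identity.) -/
def setDist (dist : κ → κ → ℕ) (A B : Finset κ) : ℕ :=
  sInf {d | ∃ a ∈ A, ∃ b ∈ B, dist a b = d}

/-- The exponential clustering property with correlation length `ξ`. It is monotone in `ξ`, so it
says that the correlation length of `ρ` is at most `ξ`. -/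
def ClustersWithin (dist : κ → κ → ℕ) (ξ : ℝ) (ρ : QState κ) : Prop :=
  ∀ (A B : Finset κ) (OA OB : Matrix (κ → Fin 2) (κ → Fin 2) ℂ),
    IsObservableOn A OA → IsObservableOn B OB →
      ‖ρ.expect (OA * OB) - ρ.expect OA * ρ.expect OB‖ ≤
        specNorm OA * specNorm OB * Real.exp (-(setDist dist A B : ℝ) / ξ)

end Qubits

/-- The `D`-dimensional hypercubic lattice with side lengths `L 0, …, L (D - 1)`. -/
abbrev Site {D : ℕ} (L : Fin D → ℕ) : Type := (μ : Fin D) → Fin (L μ)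

/-- The `ℓ¹` lattice distance with periodic boundary condition. -/
def latticeDist {D : ℕ} {L : Fin D → ℕ} (a b : Site L) : ℕ :=
  ∑ μ, min ((a μ : ℤ) - (b μ : ℤ)).natAbs (L μ - ((a μ : ℤ) - (b μ : ℤ)).natAbs)

/-! ## Polynomials in a quantum state -/

section Polynomials

variable {κ : Type*} [Fintype κ] [DecidableEq κ]

variable (κ) in
/-- The data of a degree-`p` polynomial `g(ρ) = ∑ i, c i * ∏ j, tr (P i j * ρ)`, with real
coefficients `c i` and Pauli strings `P i j`, `j = 1, …, p`. -/
structure StatePoly (p : ℕ) where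
  /-- the number of terms -/
  numTerms : ℕ
  /-- the coefficients -/
  coeff : Fin numTerms → ℝ
  /-- the Pauli strings -/
  string : Fin numTerms → Fin p → κ → Fin 4

variable {p : ℕ}

/-- All Pauli strings of `g` have weight at most `m`. -/
def StatePoly.IsBody (g : StatePoly κ p) (m : ℕ) : Prop :=
  ∀ i j, pauliWeight (g.string i j) ≤ m

/-- The `ℓ¹`-norm of the Pauli coefficients. -/
def StatePoly.l1norm (g : StatePoly κ p) : ℝ := ∑ i, |g.coeff i|

/-- The value `g(ρ)`. (Expectation values of Pauli strings are real.) -/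
def StatePoly.eval (g : StatePoly κ p) (ρ : QState κ) : ℝ :=
  ∑ i, g.coeff i * ∏ j, (ρ.expect (pauliString (g.string i j))).re

end Polynomials

/-! ## Classical shadows from random Pauli measurements -/

section Shadows

variable {κ : Type*} [Fintype κ] [DecidableEq κ] {T : ℕ}

variable (κ) in
/-- The record of one round: for each qubit the measurement basis `0, 1, 2` (for `X, Y, Z`) and
the outcome, where `0` stands for `+1` and `1` stands for `-1`. -/
abbrev Shot : Type _ := κ → Fin 3 × Fin 2

variable (κ T) in
/-- A classical shadow of size `T`: the record of `T` rounds. -/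
abbrev Shadow : Type _ := Fin T → Shot κ

/-- The operator `o W` of a single-qubit record with basis `W` and outcome `o`. -/
def signedPauli (x : Fin 3 × Fin 2) : Matrix (Fin 2) (Fin 2) ℂ :=
  ((-1 : ℂ) ^ (x.2 : ℕ)) • pauli x.1.succ

/-- The projection `(I + o W) / 2` onto the eigenspace of `W` with eigenvalue `o`. -/
def outcomeProj (x : Fin 3 × Fin 2) : Matrix (Fin 2) (Fin 2) ℂ :=
  (1 / 2 : ℂ) • (1 + signedPauli x)

/-- The probability of a record when every qubit of `ρ` is measured in an independent, uniformly
random Pauli basis: `3⁻ⁿ` for the bases, times the Born probability of the outcomes. -/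
def shotProb (ρ : QState κ) (x : Shot κ) : ℝ :=
  (1 / 3 : ℝ) ^ Fintype.card κ * (ρ.expect (tensor fun k => outcomeProj (x k))).re

/-- The law of a classical shadow of `ρ` of size `T`: the rounds are independent. -/
def shadowLaw (T : ℕ) (ρ : QState κ) : Measure (Shadow κ T) :=
  ∑ s : Shadow κ T, ENNReal.ofReal (∏ t, shotProb ρ (s t)) • Measure.dirac s

lemma tensor_mul (A B : κ → Matrix (Fin 2) (Fin 2) ℂ) :
    tensor A * tensor B = tensor fun k => A k * B k := by
  ext a b
  simp only [tensor, Matrix.mul_apply, Matrix.of_apply, ← Finset.prod_mul_distrib]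
  rw [Finset.prod_univ_sum, Fintype.piFinset_univ]

lemma tensor_conjTranspose (A : κ → Matrix (Fin 2) (Fin 2) ℂ) :
    (tensor A).conjTranspose = tensor fun k => (A k).conjTranspose := by
  ext a b
  simp [tensor, Matrix.conjTranspose_apply]

lemma outcomeProj_conjTranspose (x : Fin 3 × Fin 2) :
    (outcomeProj x).conjTranspose = outcomeProj x := by
  obtain ⟨w, o⟩ := x
  ext a b
  fin_cases w <;> fin_cases o <;> fin_cases a <;> fin_cases b <;>
    simp [outcomeProj, signedPauli, pauli, Matrix.one_fin_two]

lemma outcomeProj_mul_self (x : Fin 3 × Fin 2) :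
    outcomeProj x * outcomeProj x = outcomeProj x := by
  obtain ⟨w, o⟩ := x
  ext a b
  fin_cases w <;> fin_cases o <;> fin_cases a <;> fin_cases b <;>
    simp [outcomeProj, signedPauli, pauli, Matrix.one_fin_two] <;> ring_nf <;> norm_num

lemma sum_outcomeProj : ∑ x, outcomeProj x = (3 : ℂ) • 1 := by
  ext a b
  fin_cases a <;> fin_cases b <;>
    simp [Fintype.sum_prod_type, Fin.sum_univ_succ, outcomeProj, signedPauli, pauli,
      Matrix.one_fin_two] <;> norm_num

/-- Born probabilities are nonnegative. -/
lemma shotProb_nonneg (ρ : QState κ) (x : Shot κ) : 0 ≤ shotProb ρ x := by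
  refine mul_nonneg (by positivity) ?_
  have h : tensor (fun k => outcomeProj (x k)) =
      (tensor fun k => outcomeProj (x k)).conjTranspose * tensor fun k => outcomeProj (x k) := by
    simp only [tensor_conjTranspose, tensor_mul, outcomeProj_conjTranspose, outcomeProj_mul_self]
  rw [QState.expect, h, Matrix.mul_assoc, Matrix.trace_mul_comm]
  exact (Complex.le_def.1
    (ρ.posSemidef.mul_mul_conjTranspose_same (tensor fun k => outcomeProj (x k))).trace_nonneg).1

lemma sum_shotProb (ρ : QState κ) : ∑ x, shotProb ρ x = 1 := by
  have h : ∑ x : Shot κ, tensor (fun k => outcomeProj (x k)) =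
      ((3 : ℂ) ^ Fintype.card κ) • (1 : Matrix (κ → Fin 2) (κ → Fin 2) ℂ) := by
    ext a b
    have h1 := Finset.prod_univ_sum (fun _ : κ => (Finset.univ : Finset (Fin 3 × Fin 2)))
      (fun k x => outcomeProj x (a k) (b k))
    rw [Fintype.piFinset_univ] at h1
    simp only [Matrix.sum_apply, tensor, Matrix.of_apply, Matrix.smul_apply]
    rw [← h1]
    have h2 (k : κ) : ∑ x, outcomeProj x (a k) (b k) = if a k = b k then 3 else 0 := by
      rw [← Matrix.sum_apply, sum_outcomeProj]
      simp [Matrix.one_apply]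
    simp only [h2]
    by_cases hab : a = b
    · subst hab
      simp
    · obtain ⟨k, hk⟩ := Function.ne_iff.1 hab
      rw [Finset.prod_eq_zero (Finset.mem_univ k) (by simp [hk])]
      simp [hab]
  simp only [shotProb, ← Finset.mul_sum, ← Complex.re_sum, QState.expect, ← Matrix.trace_sum,
    ← Matrix.sum_mul, h]
  have h3 : ((3 : ℂ) ^ Fintype.card κ) = ((3 ^ Fintype.card κ : ℝ) : ℂ) := by push_cast; rfl
  rw [Matrix.smul_mul, Matrix.one_mul, Matrix.trace_smul, ρ.trace_eq_one, smul_eq_mul, mul_one,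
    h3, Complex.ofReal_re, ← mul_pow]
  norm_num

instance (T : ℕ) (ρ : QState κ) : IsProbabilityMeasure (shadowLaw T ρ) := by
  constructor
  have h0 (s : Shadow κ T) : 0 ≤ ∏ t, shotProb ρ (s t) :=
    Finset.prod_nonneg fun t _ => shotProb_nonneg ρ (s t)
  have h1 := Finset.prod_univ_sum (fun _ : Fin T => (Finset.univ : Finset (Shot κ)))
    (fun _ x => shotProb ρ x)
  rw [Fintype.piFinset_univ] at h1
  simp only [shadowLaw, Measure.coe_finsetSum, Finset.sum_apply, Measure.smul_apply,
    measure_univ, smul_eq_mul, mul_one]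
  rw [← ENNReal.ofReal_sum_of_nonneg fun s _ => h0 s, ← h1]
  simp [sum_shotProb]

lemma measurable_entry (a b : κ → Fin 2) : Measurable fun ρ : QState κ => ρ.mat a b :=
  (measurable_pi_apply b).comp ((measurable_pi_apply a).comp
    (comap_measurable fun ρ : QState κ => fun a b => ρ.mat a b))

lemma measurable_expect_re (O : Matrix (κ → Fin 2) (κ → Fin 2) ℂ) :
    Measurable fun ρ : QState κ => (ρ.expect O).re := by
  refine Complex.measurable_re.comp ?_
  simp only [QState.expect, Matrix.trace, Matrix.diag, Matrix.mul_apply]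
  exact Finset.measurable_sum _ fun a _ => Finset.measurable_sum _ fun b _ =>
    (measurable_entry b a).const_mul _

lemma measurable_eval {p : ℕ} (g : StatePoly κ p) : Measurable g.eval :=
  Finset.measurable_sum _ fun _ _ => Measurable.const_mul
    (Finset.measurable_prod _ fun _ _ => measurable_expect_re _) _

lemma measurable_sampleLaw (T : ℕ) {p : ℕ} (g : StatePoly κ p) :
    Measurable fun ρ : QState κ => (shadowLaw T ρ).map fun s => (s, g.eval ρ) := by
  refine Measure.measurable_of_measurable_coe _ fun A hA => ?_
  have h (ρ : QState κ) : ((shadowLaw T ρ).map fun s => (s, g.eval ρ)) A =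
      ∑ s : Shadow κ T, ENNReal.ofReal (∏ t, shotProb ρ (s t)) *
        A.indicator 1 (s, g.eval ρ) := by
    rw [Measure.map_apply (measurable_of_finite _) hA]
    simp only [shadowLaw, Measure.coe_finsetSum, Finset.sum_apply, Measure.smul_apply,
      smul_eq_mul]
    refine Finset.sum_congr rfl fun s _ => ?_
    rw [Measure.dirac_apply]
    rfl
  simp only [h]
  refine Finset.measurable_sum _ fun s _ => Measurable.mul ?_ ?_
  · exact ENNReal.measurable_ofReal.comp (Finset.measurable_prod _ fun t _ =>
      (measurable_expect_re _).const_mul _)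
  · exact (measurable_one.indicator hA).comp (measurable_const.prodMk (measurable_eval g))

/-- The law of the labelled sample `(S_T(ρ), g(ρ))`, where `ρ` has law `μ` and `S_T(ρ)` is a
classical shadow of `ρ` of size `T`. -/
def dataLaw (T : ℕ) {p : ℕ} (g : StatePoly κ p) (μ : Measure (QState κ)) :
    Measure (Shadow κ T × ℝ) :=
  μ.bind fun ρ => (shadowLaw T ρ).map fun s => (s, g.eval ρ)

instance (T : ℕ) {p : ℕ} (g : StatePoly κ p) (μ : Measure (QState κ)) [IsProbabilityMeasure μ] :
    IsProbabilityMeasure (dataLaw T g μ) := by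
  constructor
  rw [dataLaw, Measure.bind_apply MeasurableSet.univ (measurable_sampleLaw T g).aemeasurable]
  have h (ρ : QState κ) : ((shadowLaw T ρ).map fun s => (s, g.eval ρ)) Set.univ = 1 := by
    rw [Measure.map_apply (measurable_of_finite _) MeasurableSet.univ]
    simp
  simp [h]

/-- The single-qubit shadow `(3 o W + I) / 2`. -/
def localShadow (x : Fin 3 × Fin 2) : Matrix (Fin 2) (Fin 2) ℂ :=
  (1 / 2 : ℂ) • ((3 : ℂ) • signedPauli x + 1)

/-- The shadow kernel. -/
def shadowKernel (τ γ : ℝ) (s s' : Shadow κ T) : ℝ :=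
  Real.exp (τ / (T : ℝ) ^ 2 * ∑ t, ∑ t', Real.exp (γ / (Fintype.card κ : ℝ) *
    ∑ k, (localShadow (s t k) * localShadow (s' t' k)).trace.re))

/-- The reduced shadow `σ_{i₁ … i_r} = T⁻¹ ∑ t, σ_{i₁}^{(t)} ⊗ ⋯ ⊗ σ_{i_r}^{(t)}`; the indices
`i₁, …, i_r` may repeat. -/
def reducedShadow (s : Shadow κ T) {r : ℕ} (i : Fin r → κ) :
    Matrix (Fin r → Fin 2) (Fin r → Fin 2) ℂ :=
  (T : ℂ)⁻¹ • ∑ t, tensor fun l => localShadow (s t (i l))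

/-! ## The feature map of the shadow kernel -/

variable (κ) in
/-- Indices of the components of `⨁_r ⨁_{i₁, …, i_r} vec σ_{i₁ … i_r}`: a length `r`, qubits
`i₁, …, i_r` and a Pauli string on `r` qubits. -/
abbrev BlockIndex : Type _ := Σ r : ℕ, (Fin r → κ) × (Fin r → Fin 4)

variable (κ) in
/-- Indices of the components of the feature vector: a tensor power `d` and `d` block indices. -/
abbrev FeatureIndex : Type _ := Σ d : ℕ, (Fin d → BlockIndex κ)

/-- The components of `⨁_r √((γ / n) ^ r / r!) ⨁_{i₁, …, i_r} vec σ_{i₁ … i_r}`, where the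
components of `vec σ_{i₁ … i_r}` are `tr (P σ_{i₁ … i_r}) / √(2 ^ r)`. -/
def blockFeature (γ : ℝ) (s : Shadow κ T) (j : BlockIndex κ) : ℝ :=
  √(1 / (j.1.factorial : ℝ) * (γ / (Fintype.card κ : ℝ)) ^ j.1) *
    ((pauliString j.2.2 * reducedShadow s j.2.1).trace.re / √(2 ^ j.1))

/-- The components of the feature vector
`⨁_d √(τ ^ d / d!) (⨁_r √((γ / n) ^ r / r!) ⨁_{i₁, …, i_r} vec σ_{i₁ … i_r})^{⊗ d}`. -/
def feature (τ γ : ℝ) (s : Shadow κ T) (x : FeatureIndex κ) : ℝ :=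
  √(τ ^ x.1 / (x.1.factorial : ℝ)) * ∏ k, blockFeature γ s (x.2 k)


lemma trace_tensor_mul {l : Type*} [Fintype l] [DecidableEq l] (A B : l → Matrix (Fin 2) (Fin 2) ℂ) :
    (tensor A * tensor B).trace = ∏ k, (A k * B k).trace := by
  simp only [Matrix.trace, Matrix.diag, Matrix.mul_apply, tensor, Matrix.of_apply,
    ← Finset.prod_mul_distrib]
  have h1 : ∀ a : l → Fin 2, ∑ b : l → Fin 2, ∏ k, (A k (a k) (b k) * B k (b k) (a k)) =
      ∏ k, ∑ b, A k (a k) b * B k b (a k) := fun a => by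
    rw [Finset.prod_univ_sum, Fintype.piFinset_univ]
  simp only [h1]
  rw [Finset.prod_univ_sum, Fintype.piFinset_univ]

/-- The coefficients of local shadows in the Pauli basis. -/
lemma trace_pauli_localShadow (P : Fin 4) (x : Fin 3 × Fin 2) :
    (pauli P * localShadow x).trace =
      ((if P = 0 then 1 else if P = x.1.succ then 3 * (-1) ^ (x.2 : ℕ) else 0 : ℝ) : ℂ) := by
  obtain ⟨w, o⟩ := x
  fin_cases P <;> fin_cases w <;> fin_cases o <;>
    simp [pauli, localShadow, signedPauli, Matrix.trace_fin_two, Matrix.one_fin_two,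
      Fin.ext_iff] <;> ring_nf <;> simp

lemma trace_localShadow_mul (x y : Fin 3 × Fin 2) :
    (localShadow x * localShadow y).trace =
      (1 / 2 : ℂ) * (3 * (-1) ^ (x.2 : ℕ) * (pauli x.1.succ * localShadow y).trace +
        (pauli 0 * localShadow y).trace) := by
  nth_rewrite 1 [localShadow]
  rw [show pauli 0 = 1 from rfl]
  simp [signedPauli, Matrix.add_mul, smul_smul]
  ring

lemma localShadow_inner (x y : Fin 3 × Fin 2) :
    ∑ P, (pauli P * localShadow x).trace.re * (pauli P * localShadow y).trace.re / 2 =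
      (localShadow x * localShadow y).trace.re := by
  have h : (localShadow x * localShadow y).trace =
      (((1 / 2) * (3 * (-1) ^ (x.2 : ℕ) *
        (if x.1 = y.1 then 3 * (-1) ^ (y.2 : ℕ) else 0) + 1) : ℝ) : ℂ) := by
    rw [trace_localShadow_mul, trace_pauli_localShadow, trace_pauli_localShadow]
    simp only [Fin.succ_ne_zero, if_false, if_true, Fin.succ_inj]
    push_cast
    ring
  rw [h, Complex.ofReal_re, Fin.sum_univ_succ]
  simp only [trace_pauli_localShadow, Complex.ofReal_re, Fin.succ_ne_zero, if_false, if_true,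
    Fin.succ_inj]
  rw [Finset.sum_eq_single x.1 (by
    intro i _ hi
    simp [hi]) (by simp)]
  simp only [if_true]
  ring

lemma hasSum_pi_prod {J : Type*} (f : J → ℝ) (hf : Summable f) (d : ℕ) :
    HasSum (fun x : Fin d → J => ∏ k, f (x k)) ((∑' j, f j) ^ d) := by
  induction d with
  | zero => simp
  | succ d ih =>
    rw [← (Fin.consEquiv (fun _ => J)).hasSum_iff, pow_succ']
    have hs : Summable fun x : J × (Fin d → J) => f x.1 * ∏ k, f (x.2 k) :=
      summable_mul_of_summable_norm (f := f) (g := fun x : Fin d → J => ∏ k, f (x k))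
        hf.norm ih.summable.norm
    have h := HasSum.mul hf.hasSum ih hs
    have e : (fun x : Fin (d + 1) → J => ∏ k, f (x k)) ∘ (Fin.consEquiv fun _ => J) =
        fun x : J × (Fin d → J) => f x.1 * ∏ k, f (x.2 k) := by
      funext x
      simp only [Function.comp_apply, Fin.consEquiv_apply, Fin.prod_univ_succ, Fin.cons_zero,
        Fin.cons_succ]
    rw [e]
    exact h


/-- The traces of Pauli strings against reduced shadows are real. -/
lemma trace_pauliString_reducedShadow_re (s : Shadow κ T) {r : ℕ} (i : Fin r → κ)
    (P : Fin r → Fin 4) : (pauliString P * reducedShadow s i).trace.re =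
      (T : ℝ)⁻¹ * ∑ t, ∏ l, (pauli (P l) * localShadow (s t (i l))).trace.re := by
  have h : (pauliString P * reducedShadow s i).trace =
      (((T : ℝ)⁻¹ * ∑ t, ∏ l, (pauli (P l) * localShadow (s t (i l))).trace.re : ℝ) : ℂ) := by
    have h' (t : Fin T) (l : Fin r) : (((pauli (P l) * localShadow (s t (i l))).trace.re : ℝ) : ℂ) =
        (pauli (P l) * localShadow (s t (i l))).trace := by
      rw [trace_pauli_localShadow, Complex.ofReal_re]
    push_cast
    simp only [h', reducedShadow, pauliString, Matrix.mul_smul, Matrix.mul_sum, Matrix.trace_smul,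
      Matrix.trace_sum, trace_tensor_mul, smul_eq_mul]
  rw [h, Complex.ofReal_re]

lemma sum_block (s s' : Shadow κ T) (r : ℕ) :
    ∑ j : (Fin r → κ) × (Fin r → Fin 4),
        (pauliString j.2 * reducedShadow s j.1).trace.re *
          (pauliString j.2 * reducedShadow s' j.1).trace.re / 2 ^ r =
      ((T : ℝ) ^ 2)⁻¹ * ∑ t, ∑ t',
        (∑ k, (localShadow (s t k) * localShadow (s' t' k)).trace.re) ^ r := by
  have h1 (t t' : Fin T) :
      (∑ k, (localShadow (s t k) * localShadow (s' t' k)).trace.re) ^ r =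
        ∑ i : Fin r → κ, ∑ P : Fin r → Fin 4,
          ∏ l, ((pauli (P l) * localShadow (s t (i l))).trace.re *
            (pauli (P l) * localShadow (s' t' (i l))).trace.re / 2) := by
    have h2 : (∑ k, (localShadow (s t k) * localShadow (s' t' k)).trace.re) ^ r =
        ∏ _l : Fin r, ∑ k, (localShadow (s t k) * localShadow (s' t' k)).trace.re := by simp
    rw [h2, Finset.prod_univ_sum, Fintype.piFinset_univ]
    refine Finset.sum_congr rfl fun i _ => ?_
    simp only [← localShadow_inner]
    rw [Finset.prod_univ_sum, Fintype.piFinset_univ]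
  simp only [h1, Fintype.sum_prod_type, trace_pauliString_reducedShadow_re]
  have h3 (i : Fin r → κ) (P : Fin r → Fin 4) :
      (T : ℝ)⁻¹ * (∑ t, ∏ l, (pauli (P l) * localShadow (s t (i l))).trace.re) *
        ((T : ℝ)⁻¹ * ∑ t, ∏ l, (pauli (P l) * localShadow (s' t (i l))).trace.re) / 2 ^ r =
      ((T : ℝ) ^ 2)⁻¹ * ∑ t, ∑ t', ∏ l, ((pauli (P l) * localShadow (s t (i l))).trace.re *
            (pauli (P l) * localShadow (s' t' (i l))).trace.re / 2) := by
    simp only [Finset.prod_div_distrib, Finset.prod_mul_distrib, Finset.prod_const,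
      Finset.card_univ, Fintype.card_fin, ← Finset.sum_div, ← Finset.mul_sum, ← Finset.sum_mul]
    ring
  simp only [h3, ← Finset.mul_sum]
  congr 1
  rw [Finset.sum_congr rfl fun i _ => Finset.sum_comm]
  rw [Finset.sum_comm]
  refine Finset.sum_congr rfl fun t _ => ?_
  rw [Finset.sum_congr rfl fun i _ => Finset.sum_comm]
  rw [Finset.sum_comm]

/-- The inner product of two block feature vectors, in the nonnegative case. -/
lemma block_hasSum_fiber {γ : ℝ} (hγ : 0 ≤ γ) (s s' : Shadow κ T) :
    HasSum (fun r : ℕ => ∑ j : (Fin r → κ) × (Fin r → Fin 4),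
        blockFeature γ s ⟨r, j⟩ * blockFeature γ s' ⟨r, j⟩)
      (((T : ℝ) ^ 2)⁻¹ * ∑ t, ∑ t', Real.exp (γ / (Fintype.card κ : ℝ) *
        ∑ k, (localShadow (s t k) * localShadow (s' t' k)).trace.re)) := by
  have h (r : ℕ) : ∑ j : (Fin r → κ) × (Fin r → Fin 4),
        blockFeature γ s ⟨r, j⟩ * blockFeature γ s' ⟨r, j⟩ =
      ((T : ℝ) ^ 2)⁻¹ * ∑ t, ∑ t', (γ / (Fintype.card κ : ℝ) *
        ∑ k, (localShadow (s t k) * localShadow (s' t' k)).trace.re) ^ r / r.factorial := by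
    have h0 : 0 ≤ 1 / (r.factorial : ℝ) * (γ / (Fintype.card κ : ℝ)) ^ r := by positivity
    have hj (j : (Fin r → κ) × (Fin r → Fin 4)) :
        blockFeature γ s ⟨r, j⟩ * blockFeature γ s' ⟨r, j⟩ =
        1 / (r.factorial : ℝ) * (γ / (Fintype.card κ : ℝ)) ^ r *
          ((pauliString j.2 * reducedShadow s j.1).trace.re *
          (pauliString j.2 * reducedShadow s' j.1).trace.re / 2 ^ r) := by
      have e1 := Real.mul_self_sqrt h0
      have e2 : √((2 : ℝ) ^ r) * √(2 ^ r) = 2 ^ r := Real.mul_self_sqrt (by positivity)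
      have e3 (a b x y : ℝ) : a * (x / b) * (a * (y / b)) = a * a * (x * y / (b * b)) := by
        simp only [div_eq_mul_inv, mul_inv]
        ring
      rw [blockFeature, blockFeature, e3, e1, e2]
    simp only [hj]
    rw [← Finset.mul_sum, sum_block]
    simp only [mul_pow, mul_div_right_comm, ← Finset.mul_sum]
    ring
  simp only [h]
  refine HasSum.mul_left _ (hasSum_sum fun t _ => hasSum_sum fun t' _ => ?_)
  rw [Real.exp_eq_exp_ℝ]
  exact NormedSpace.expSeries_div_hasSum_exp _

lemma summable_blockFeature_sq {γ : ℝ} (hγ : 0 ≤ γ) (s : Shadow κ T) :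
    Summable fun j => blockFeature γ s j * blockFeature γ s j := by
  rw [summable_sigma_of_nonneg fun j => mul_self_nonneg _]
  refine ⟨fun r => Summable.of_finite, ?_⟩
  simp only [tsum_fintype]
  exact (block_hasSum_fiber hγ s s).summable

lemma summable_blockFeature_mul {γ : ℝ} (hγ : 0 ≤ γ) (s s' : Shadow κ T) :
    Summable fun j => blockFeature γ s j * blockFeature γ s' j := by
  refine Summable.of_norm_bounded
    ((summable_blockFeature_sq hγ s).add (summable_blockFeature_sq hγ s')) fun j => ?_
  rw [Real.norm_eq_abs, abs_le]
  constructor <;> nlinarith [sq_nonneg (blockFeature γ s j + blockFeature γ s' j),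
    sq_nonneg (blockFeature γ s j - blockFeature γ s' j)]

lemma tsum_blockFeature_mul {γ : ℝ} (hγ : 0 ≤ γ) (s s' : Shadow κ T) :
    ∑' j, blockFeature γ s j * blockFeature γ s' j =
      ((T : ℝ) ^ 2)⁻¹ * ∑ t, ∑ t', Real.exp (γ / (Fintype.card κ : ℝ) *
        ∑ k, (localShadow (s t k) * localShadow (s' t' k)).trace.re) := by
  rw [(summable_blockFeature_mul hγ s s').tsum_sigma' fun r => Summable.of_finite]
  simp only [tsum_fintype]
  exact (block_hasSum_fiber hγ s s').tsum_eq

lemma feature_hasSum_fiber {τ γ : ℝ} (hτ : 0 ≤ τ) (hγ : 0 ≤ γ) (s s' : Shadow κ T) (d : ℕ) :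
    HasSum (fun x : Fin d → BlockIndex κ => feature τ γ s ⟨d, x⟩ * feature τ γ s' ⟨d, x⟩)
      (τ ^ d / d.factorial * (∑' j, blockFeature γ s j * blockFeature γ s' j) ^ d) := by
  have h := (hasSum_pi_prod _ (summable_blockFeature_mul hγ s s') d).mul_left
    (τ ^ d / (d.factorial : ℝ))
  have e (x : Fin d → BlockIndex κ) : feature τ γ s ⟨d, x⟩ * feature τ γ s' ⟨d, x⟩ =
      τ ^ d / (d.factorial : ℝ) * ∏ k, blockFeature γ s (x k) * blockFeature γ s' (x k) := by
    have e1 := Real.mul_self_sqrt (show 0 ≤ τ ^ d / (d.factorial : ℝ) by positivity)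
    rw [feature, feature, mul_mul_mul_comm, e1, Finset.prod_mul_distrib]
  simp only [e]
  exact h

lemma feature_hasSum_exp {τ γ : ℝ} (s s' : Shadow κ T) :
    HasSum (fun d : ℕ =>
        τ ^ d / (d.factorial : ℝ) * (∑' j, blockFeature γ s j * blockFeature γ s' j) ^ d)
      (Real.exp (τ * ∑' j, blockFeature γ s j * blockFeature γ s' j)) := by
  rw [Real.exp_eq_exp_ℝ]
  have h : (fun d : ℕ =>
      τ ^ d / (d.factorial : ℝ) * (∑' j, blockFeature γ s j * blockFeature γ s' j) ^ d) =
      fun d => (τ * ∑' j, blockFeature γ s j * blockFeature γ s' j) ^ d / (d.factorial : ℝ) := by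
    funext d
    rw [mul_pow]
    ring
  rw [h]
  exact NormedSpace.expSeries_div_hasSum_exp _

lemma summable_feature_sq {τ γ : ℝ} (hτ : 0 ≤ τ) (hγ : 0 ≤ γ) (s : Shadow κ T) :
    Summable fun x => feature τ γ s x * feature τ γ s x := by
  rw [summable_sigma_of_nonneg fun j => mul_self_nonneg _]
  refine ⟨fun d => (feature_hasSum_fiber hτ hγ s s d).summable, ?_⟩
  have h : (fun d => ∑' x : Fin d → BlockIndex κ, feature τ γ s ⟨d, x⟩ * feature τ γ s ⟨d, x⟩) =
      fun d => _ := funext fun d => (feature_hasSum_fiber hτ hγ s s d).tsum_eq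
  rw [h]
  exact (feature_hasSum_exp s s).summable

lemma memℓp_feature {τ γ : ℝ} (hτ : 0 ≤ τ) (hγ : 0 ≤ γ) (s : Shadow κ T) :
    Memℓp (E := fun _ : FeatureIndex κ => ℝ) (feature τ γ s) 2 := by
  refine memℓp_gen ?_
  convert summable_feature_sq hτ hγ s using 2 with x
  simp [sq]

variable (κ) in
/-- The feature space `ℓ²` of the shadow kernel. -/
abbrev FeatureSpace : Type _ := lp (fun _ : FeatureIndex κ => ℝ) 2

/-- The feature map of the shadow kernel with hyperparameters `τ, γ > 0`. -/
def featureMap {τ γ : ℝ} (hτ : 0 < τ) (hγ : 0 < γ) (s : Shadow κ T) : FeatureSpace κ :=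
  ⟨feature τ γ s, memℓp_feature hτ.le hγ.le s⟩

/-- The shadow kernel is the inner product of the feature vectors. -/
theorem inner_featureMap {τ γ : ℝ} (hτ : 0 < τ) (hγ : 0 < γ) (s s' : Shadow κ T) :
    inner ℝ (featureMap hτ hγ s) (featureMap hτ hγ s') = shadowKernel τ γ s s' := by
  have hsum : Summable fun x => feature τ γ s x * feature τ γ s' x := by
    refine (lp.summable_inner (𝕜 := ℝ) (featureMap hτ hγ s') (featureMap hτ hγ s)).congr
      fun x => ?_
    simp [featureMap]
  rw [lp.inner_eq_tsum]
  have h1 : ∑' x, inner ℝ (featureMap hτ hγ s x) (featureMap hτ hγ s' x) =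
      ∑' x, feature τ γ s x * feature τ γ s' x := by
    refine tsum_congr fun x => ?_
    simp [featureMap, mul_comm]
  have h2 : (fun d => ∑' x : Fin d → BlockIndex κ, feature τ γ s ⟨d, x⟩ * feature τ γ s' ⟨d, x⟩) =
      fun d => _ := funext fun d => (feature_hasSum_fiber hτ.le hγ.le s s' d).tsum_eq
  rw [h1, hsum.tsum_sigma' fun d => (feature_hasSum_fiber hτ.le hγ.le s s' d).summable, h2,
    (feature_hasSum_exp s s').tsum_eq, tsum_blockFeature_mul hγ.le, shadowKernel, ← mul_assoc,
    div_eq_mul_inv τ]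

/-! ## Kernel ridge regression -/

/-- The squared loss `(y - ⟨w, φ(x)⟩)² / 2` of the dual vector `w` at the sample `z = (x, y)`. -/
def sqLoss {X H : Type*} [NormedAddCommGroup H] [InnerProductSpace ℝ H] (φ : X → H) (w : H)
    (z : X × ℝ) : ℝ :=
  (z.2 - inner ℝ w (φ z.1)) ^ 2 / 2

/-- The expected loss. -/
def expectedLoss {X H : Type*} [MeasurableSpace X] [NormedAddCommGroup H] [InnerProductSpace ℝ H]
    (φ : X → H) (𝒟 : Measure (X × ℝ)) (w : H) : ℝ :=
  ∫ z, sqLoss φ w z ∂𝒟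

/-- The empirical loss on the training data `Z`. -/
def empiricalLoss {X H : Type*} [NormedAddCommGroup H] [InnerProductSpace ℝ H] (φ : X → H) {N : ℕ}
    (Z : Fin N → X × ℝ) (w : H) : ℝ :=
  (N : ℝ)⁻¹ * ∑ i, sqLoss φ w (Z i)

/-- `w` solves the ridge regression problem with training data `Z`: it minimises
`L_Z(w) + lam * ‖w‖²` subject to `‖w‖² ≤ Bsq`. -/
def IsRidgeSolution {X H : Type*} [NormedAddCommGroup H] [InnerProductSpace ℝ H] (φ : X → H)
    (lam Bsq : ℝ) {N : ℕ} (Z : Fin N → X × ℝ) (w : H) : Prop :=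
  ‖w‖ ^ 2 ≤ Bsq ∧ ∀ v : H, ‖v‖ ^ 2 ≤ Bsq →
    empiricalLoss φ Z w + lam * ‖w‖ ^ 2 ≤ empiricalLoss φ Z v + lam * ‖v‖ ^ 2

end Shadows

end QShadow

end

open QShadow

/-! Kernel ridge regression is linear regression in the feature space, so two things are needed: a
good weight vector of norm at most `B`, and a proof that the learner does nearly as well as it.

The competitor is explicit. Up to a known scale, the feature vector contains every product of `p`
shadow estimates of Pauli strings as one coordinate: take tensor power `d = p` and, in each slot,
the block indexed by the support of the string (`feature_productIndex`). A finite combination of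
basis vectors, `StatePoly.weight`, therefore predicts exactly the plug-in estimate of `g`
(`inner_weight`), and crude factorial bounds keep its squared norm below `B²` (`norm_weight_le`,
`abs_inv_productScale_le`). Its loss is pure sampling error: the estimator is unbiased and bounded
by `3 ^ m` in each round, so Hoeffding's inequality and a union bound over the `p` factors give loss
at most `5/16 * ε²` for every state (`integral_sq_prod_sub_prod_le`, `error_bound`,
`integral_sqLoss_weight_le`).

Generalisation follows from algorithmic stability. Strong convexity of the regularised objective
(`IsRidgeSolution.growth`) shows that replacing one sample moves the solution by `O(1 / (lam * N))`,
and the loss at that sample changes by at most a small multiple of the losses themselves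
(`IsRidgeSolution.sqLoss_sub_le`). Exchangeability of `N + 1` samples turns this into `b - a ≤ κ (b
+ a)` for expected test loss `b` and training loss `a`, with `κ = R² / (lam * N)`
(`integral_expectedLoss_sub_le`). Since the bound is relative to the losses, the a priori bound `G²
/ 2` on `a` suffices, where `G` bounds the labels; the cruder bound through `B * R` never enters the
rate (`integral_expectedLoss_ridge_le`). -/

noncomputable section

open scoped ComplexOrder

set_option linter.unusedSectionVars false

namespace QShadow

/-! ### Deterministic theory of constrained ridge regression: strong convexity, existence,
stability. -/

section RidgeRegression

variable {X H : Type*} [NormedAddCommGroup H] [InnerProductSpace ℝ H]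

/-- The regularised empirical loss. -/
def ridgeObjective (φ : X → H) (lam : ℝ) {N : ℕ} (Z : Fin N → X × ℝ) (w : H) : ℝ :=
  empiricalLoss φ Z w + lam * ‖w‖ ^ 2

lemma sqLoss_nonneg (φ : X → H) (w : H) (z : X × ℝ) : 0 ≤ sqLoss φ w z := by
  unfold sqLoss; positivity

lemma empiricalLoss_nonneg (φ : X → H) {N : ℕ} (Z : Fin N → X × ℝ) (w : H) :
    0 ≤ empiricalLoss φ Z w :=
  mul_nonneg (by positivity) (Finset.sum_nonneg fun _ _ => sqLoss_nonneg _ _ _)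

lemma sqLoss_convexComb_le (φ : X → H) (z : X × ℝ) (v w : H) {t : ℝ} (h0 : 0 ≤ t) (h1 : t ≤ 1) :
    sqLoss φ ((1 - t) • w + t • v) z ≤ (1 - t) * sqLoss φ w z + t * sqLoss φ v z := by
  simp only [sqLoss, inner_add_left, real_inner_smul_left]
  nlinarith [mul_nonneg (mul_nonneg h0 (sub_nonneg.2 h1))
    (sq_nonneg (inner ℝ w (φ z.1) - inner ℝ v (φ z.1)))]

lemma norm_sq_convexComb (v w : H) (t : ℝ) :
    ‖(1 - t) • w + t • v‖ ^ 2 = (1 - t) * ‖w‖ ^ 2 + t * ‖v‖ ^ 2 - t * (1 - t) * ‖v - w‖ ^ 2 := by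
  rw [norm_add_sq_real, norm_sub_sq_real, norm_smul, norm_smul, real_inner_smul_left,
    real_inner_smul_right, mul_pow, mul_pow, Real.norm_eq_abs, Real.norm_eq_abs, sq_abs, sq_abs,
    real_inner_comm]
  ring

/-- The empirical loss is merely convex; the strong convexity, with modulus proportional to `lam`,
comes entirely from the exact identity for the squared norm. -/
lemma ridgeObjective_convexComb_le (φ : X → H) (lam : ℝ) {N : ℕ} (Z : Fin N → X × ℝ)
    (v w : H) {t : ℝ} (h0 : 0 ≤ t) (h1 : t ≤ 1) :
    ridgeObjective φ lam Z ((1 - t) • w + t • v) ≤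
      (1 - t) * ridgeObjective φ lam Z w + t * ridgeObjective φ lam Z v -
        lam * (t * (1 - t)) * ‖v - w‖ ^ 2 := by
  have h : empiricalLoss φ Z ((1 - t) • w + t • v) ≤
      (1 - t) * empiricalLoss φ Z w + t * empiricalLoss φ Z v := by
    have hs := Finset.sum_le_sum fun i (_ : i ∈ Finset.univ) =>
      sqLoss_convexComb_le φ (Z i) v w h0 h1
    rw [Finset.sum_add_distrib, ← Finset.mul_sum, ← Finset.mul_sum] at hs
    have := mul_le_mul_of_nonneg_left hs (show (0 : ℝ) ≤ (N : ℝ)⁻¹ by positivity)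
    unfold empiricalLoss
    linarith
  unfold ridgeObjective
  rw [norm_sq_convexComb]
  linarith

lemma norm_sq_convexComb_le {Bsq : ℝ} {v w : H} (hv : ‖v‖ ^ 2 ≤ Bsq) (hw : ‖w‖ ^ 2 ≤ Bsq)
    {t : ℝ} (h0 : 0 ≤ t) (h1 : t ≤ 1) : ‖(1 - t) • w + t • v‖ ^ 2 ≤ Bsq := by
  rw [norm_sq_convexComb]
  nlinarith [mul_nonneg (mul_nonneg h0 (sub_nonneg.2 h1)) (sq_nonneg ‖v - w‖),
    mul_le_mul_of_nonneg_left hv h0, mul_le_mul_of_nonneg_left hw (sub_nonneg.2 h1)]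

/-- Quadratic growth of the ridge objective at its constrained minimiser. -/
lemma IsRidgeSolution.growth {φ : X → H} {lam Bsq : ℝ} {N : ℕ} {Z : Fin N → X × ℝ} {w : H}
    (h : IsRidgeSolution φ lam Bsq Z w) {v : H} (hv : ‖v‖ ^ 2 ≤ Bsq) :
    lam * ‖v - w‖ ^ 2 ≤ ridgeObjective φ lam Z v - ridgeObjective φ lam Z w := by
  -- Compare `w` with the feasible point `(1 - t) • w + t • v` and divide by `t`; the surplus factor
  -- `1 - t` disappears as `t → 0⁺`.
  have key (t : ℝ) (h0 : 0 < t) (h1 : t < 1) : lam * ‖v - w‖ ^ 2 - t * (lam * ‖v - w‖ ^ 2) ≤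
      ridgeObjective φ lam Z v - ridgeObjective φ lam Z w := by
    have a := h.2 _ (norm_sq_convexComb_le hv h.1 h0.le h1.le)
    have b := ridgeObjective_convexComb_le φ lam Z v w h0.le h1.le
    have c : 0 ≤ t * (ridgeObjective φ lam Z v - ridgeObjective φ lam Z w -
        lam * (1 - t) * ‖v - w‖ ^ 2) := by
      simp only [ridgeObjective] at a b ⊢
      linarith
    have := nonneg_of_mul_nonneg_right c h0
    linarith
  have hlim : Filter.Tendsto (fun t : ℝ => lam * ‖v - w‖ ^ 2 - t * (lam * ‖v - w‖ ^ 2))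
      (nhdsWithin 0 (Set.Ioi 0)) (nhds (lam * ‖v - w‖ ^ 2 - 0 * (lam * ‖v - w‖ ^ 2))) :=
    (Continuous.tendsto (by fun_prop) 0).mono_left nhdsWithin_le_nhds
  rw [zero_mul, sub_zero] at hlim
  refine le_of_tendsto hlim ?_
  filter_upwards [Ioo_mem_nhdsGT (show (0 : ℝ) < 1 by norm_num)] with t ht
  exact key t ht.1 ht.2

lemma continuous_ridgeObjective (φ : X → H) (lam : ℝ) {N : ℕ} (Z : Fin N → X × ℝ) :
    Continuous (ridgeObjective φ lam Z) := by
  unfold ridgeObjective empiricalLoss sqLoss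
  fun_prop

/-- The constrained ridge regression problem has a unique solution. -/
theorem existsUnique_isRidgeSolution (φ : X → H) {lam Bsq : ℝ} (hlam : 0 < lam) (hB : 0 ≤ Bsq)
    {N : ℕ} (Z : Fin N → X × ℝ) : ∃! w, IsRidgeSolution φ lam Bsq Z w := by
  have huniq (v w : H) (hv : IsRidgeSolution φ lam Bsq Z v) (hw : IsRidgeSolution φ lam Bsq Z w) :
      v = w := by
    have h := hw.growth hv.1
    have h' := hv.2 w hw.1
    simp only [ridgeObjective] at h
    have : ‖v - w‖ ^ 2 ≤ 0 := by
      by_contra hc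
      have := mul_pos hlam (not_le.1 hc)
      linarith
    have h0 : ‖v - w‖ = 0 := by nlinarith [norm_nonneg (v - w)]
    exact sub_eq_zero.1 (norm_eq_zero.1 h0)
  -- Representer argument: balls of `H` need not be compact, but projecting onto the span of the
  -- sampled features keeps all predictions on the data and does not increase the norm. A minimiser
  -- over a ball of this finite-dimensional span is thus a minimiser over the ball of `H`.
  let V : Submodule ℝ H := Submodule.span ℝ (Set.range fun i => φ (Z i).1)
  have : FiniteDimensional ℝ V := FiniteDimensional.span_of_finite ℝ (Set.finite_range _)
  have hmem (x : V) : x ∈ Metric.closedBall (0 : V) √Bsq ↔ ‖(x : H)‖ ^ 2 ≤ Bsq := by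
    rw [mem_closedBall_zero_iff, Real.le_sqrt (norm_nonneg _) hB, Submodule.coe_norm]
  obtain ⟨u, hu, hmin⟩ := (isCompact_closedBall (0 : V) √Bsq).exists_isMinOn
    ⟨0, Metric.mem_closedBall_self (Real.sqrt_nonneg _)⟩
    ((continuous_ridgeObjective φ lam Z).comp continuous_subtype_val).continuousOn
  have hsol : IsRidgeSolution φ lam Bsq Z (u : H) := by
    refine ⟨(hmem u).1 hu, fun v hv => ?_⟩
    have hle : ‖((V.orthogonalProjectionOnto v : V) : H)‖ ^ 2 ≤ ‖v‖ ^ 2 :=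
      pow_le_pow_left₀ (norm_nonneg _) (V.norm_orthogonalProjectionOnto_apply_le v) 2
    have h := isMinOn_iff.1 hmin (V.orthogonalProjectionOnto v) ((hmem _).2 (hle.trans hv))
    have hE : empiricalLoss φ Z ((V.orthogonalProjectionOnto v : V) : H) =
        empiricalLoss φ Z v := by
      have hi (i : Fin N) : inner ℝ ((V.orthogonalProjectionOnto v : V) : H) (φ (Z i).1) =
          inner ℝ v (φ (Z i).1) := by
        have := V.starProjection_inner_eq_zero (𝕜 := ℝ) v (φ (Z i).1)
          (Submodule.subset_span ⟨i, rfl⟩)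
        rw [inner_sub_left] at this
        exact (sub_eq_zero.1 this).symm
      simp only [empiricalLoss, sqLoss, hi]
    simp only [Function.comp_apply, ridgeObjective, hE] at h
    have := mul_le_mul_of_nonneg_left hle hlam.le
    linarith
  exact ⟨u, hsol, fun v hv => huniq v u hv hsol⟩

lemma abs_inner_sub_le (φ : X → H) {R : ℝ} (hR : ∀ x, ‖φ x‖ ≤ R) (v w : H) (x : X) :
    |inner ℝ v (φ x) - inner ℝ w (φ x)| ≤ ‖v - w‖ * R := by
  rw [← inner_sub_left]
  exact (abs_real_inner_le_norm _ _).trans (mul_le_mul_of_nonneg_left (hR x) (norm_nonneg _))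

/-- The ridge solution is a Lipschitz function of the labels. -/
lemma IsRidgeSolution.norm_sub_le {φ : X → H} {lam Bsq R δ : ℝ} {N : ℕ}
    {Z Z' : Fin N → X × ℝ} {w w' : H} (hR0 : 0 ≤ R) (hR : ∀ x, ‖φ x‖ ≤ R)
    (h : IsRidgeSolution φ lam Bsq Z w) (h' : IsRidgeSolution φ lam Bsq Z' w')
    (hx : ∀ i, (Z i).1 = (Z' i).1) (hδ : 0 ≤ δ) (hy : ∀ i, |(Z i).2 - (Z' i).2| ≤ δ) :
    2 * lam * ‖w' - w‖ ≤ δ * R := by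
  rcases (norm_nonneg (w' - w)).eq_or_lt with h0 | h0
  · rw [← h0, mul_zero]
    exact mul_nonneg hδ hR0
  have g1 := h.growth h'.1
  have g2 := h'.growth h.1
  -- All squares cancel in this combination, leaving the product of the label difference and the
  -- prediction difference.
  have e (i : Fin N) : sqLoss φ w' (Z i) - sqLoss φ w (Z i) +
      (sqLoss φ w (Z' i) - sqLoss φ w' (Z' i)) ≤ δ * (‖w' - w‖ * R) := by
    have := abs_inner_sub_le φ hR w' w (Z i).1
    have h3 := mul_le_mul (hy i) this (abs_nonneg _) hδ
    rw [← abs_mul] at h3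
    have h4 := (abs_le.1 h3).1
    simp only [sqLoss, ← hx i]
    linarith
  have e2 : (ridgeObjective φ lam Z w' - ridgeObjective φ lam Z w) +
      (ridgeObjective φ lam Z' w - ridgeObjective φ lam Z' w') ≤ δ * (‖w' - w‖ * R) := by
    have hs := Finset.sum_le_sum fun i (_ : i ∈ Finset.univ) => e i
    simp only [Finset.sum_add_distrib, Finset.sum_sub_distrib, Finset.sum_const,
      Finset.card_univ, Fintype.card_fin, nsmul_eq_mul] at hs
    have hs' := mul_le_mul_of_nonneg_left hs (show (0 : ℝ) ≤ (N : ℝ)⁻¹ by positivity)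
    have h1 : (N : ℝ)⁻¹ * (N * (δ * (‖w' - w‖ * R))) ≤ δ * (‖w' - w‖ * R) := by
      rw [← mul_assoc]
      exact mul_le_of_le_one_left (by positivity) inv_mul_le_one
    simp only [ridgeObjective, empiricalLoss]
    linarith
  rw [norm_sub_rev w w'] at g2
  have : ‖w' - w‖ * (2 * lam * ‖w' - w‖) ≤ ‖w' - w‖ * (δ * R) := by linarith
  exact le_of_mul_le_mul_left this h0

/-- Replacing one sample changes the loss of the ridge solution at that sample only little. -/
lemma IsRidgeSolution.sqLoss_sub_le {φ : X → H} {lam Bsq R : ℝ} {N : ℕ}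
    {Z Z' : Fin N → X × ℝ} {w w' : H} (hlam : 0 < lam) (hR : ∀ x, ‖φ x‖ ≤ R)
    (h : IsRidgeSolution φ lam Bsq Z w) (h' : IsRidgeSolution φ lam Bsq Z' w')
    {i : Fin N} (hi : ∀ j, j ≠ i → Z j = Z' j) :
    sqLoss φ w' (Z i) - sqLoss φ w (Z i) ≤ R ^ 2 / (8 * (lam * N)) *
      (6 * (sqLoss φ w (Z i) + sqLoss φ w' (Z i)) +
        2 * (sqLoss φ w' (Z' i) + sqLoss φ w (Z' i))) := by
  have hR0 : 0 ≤ R := (norm_nonneg _).trans (hR (Z i).1)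
  have hN : (0 : ℝ) < N := Nat.cast_pos.2 i.pos
  have g1 := h.growth h'.1
  have g2 := h'.growth h.1
  rw [norm_sub_rev w w'] at g2
  -- Adding the two growth inequalities cancels the regularisers and every sample except the `i`-th.
  have e2 : (ridgeObjective φ lam Z w' - ridgeObjective φ lam Z w) +
      (ridgeObjective φ lam Z' w - ridgeObjective φ lam Z' w') =
      (N : ℝ)⁻¹ * ((sqLoss φ w' (Z i) - sqLoss φ w (Z i)) +
        (sqLoss φ w (Z' i) - sqLoss φ w' (Z' i))) := by
    have hs := Finset.sum_eq_single (s := Finset.univ)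
      (f := fun j => (sqLoss φ w' (Z j) - sqLoss φ w (Z j)) +
        (sqLoss φ w (Z' j) - sqLoss φ w' (Z' j))) i
      (fun j _ hj => by rw [hi j hj]; ring) (by simp)
    rw [← hs]
    simp only [Finset.sum_add_distrib, Finset.sum_sub_distrib, ridgeObjective, empiricalLoss]
    ring
  have b1 := abs_inner_sub_le φ hR w' w (Z i).1
  have b2 := abs_inner_sub_le φ hR w' w (Z' i).1
  set Δ := ‖w' - w‖
  have hΔ : 0 ≤ Δ := norm_nonneg _
  have key (y a a' : ℝ) (hd : |a' - a| ≤ Δ * R) :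
      |(|y - a'| ^ 2 / 2 - |y - a| ^ 2 / 2)| ≤ Δ * R * ((|y - a| + |y - a'|) / 2) := by
    rw [sq_abs, sq_abs, show (y - a') ^ 2 / 2 - (y - a) ^ 2 / 2 = (a' - a) * (((a - y) + (a' - y)) / 2) by ring,
      abs_mul]
    refine mul_le_mul hd ?_ (abs_nonneg _) (by positivity)
    rw [abs_div, abs_two, abs_sub_comm y a, abs_sub_comm y a']
    gcongr
    exact abs_add_le _ _
  have k1 := (abs_le.1 (key (Z i).2 _ _ b1)).2
  have k2 := (abs_le.1 (key (Z' i).2 _ _ b2)).1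
  have hsq (v : H) (z : X × ℝ) : sqLoss φ v z = |z.2 - inner ℝ v (φ z.1)| ^ 2 / 2 := by
    rw [sq_abs, sqLoss]
  simp only [hsq] at e2 ⊢
  set r := |(Z i).2 - inner ℝ w (φ (Z i).1)|
  set r1 := |(Z i).2 - inner ℝ w' (φ (Z i).1)|
  set s := |(Z' i).2 - inner ℝ w' (φ (Z' i).1)|
  set s1 := |(Z' i).2 - inner ℝ w (φ (Z' i).1)|
  have hr0 : 0 ≤ r := abs_nonneg _
  have hr10 : 0 ≤ r1 := abs_nonneg _
  have hs0 : 0 ≤ s := abs_nonneg _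
  have hs10 : 0 ≤ s1 := abs_nonneg _
  -- Growth bounds `Δ²` by a multiple of `Δ` times the residuals, so one `Δ` cancels.
  have m1 : 4 * (lam * N) * Δ ≤ R * (r + r1 + s + s1) := by
    rcases hΔ.eq_or_lt with h0 | h0
    · rw [← h0, mul_zero]; positivity
    refine le_of_mul_le_mul_left ?_ h0
    have : 2 * (lam * Δ ^ 2) ≤ (N : ℝ)⁻¹ * (Δ * R * ((r + r1 + s + s1) / 2)) := by
      refine (show _ ≤ _ from ?_ : _ ≤ (N : ℝ)⁻¹ * (r1 ^ 2 / 2 - r ^ 2 / 2 +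
        (s1 ^ 2 / 2 - s ^ 2 / 2))).trans (mul_le_mul_of_nonneg_left ?_ (by positivity))
      · linarith
      · linarith
    have := mul_le_mul_of_nonneg_left this hN.le
    rw [mul_inv_cancel_left₀ hN.ne'] at this
    linarith
  rw [div_mul_eq_mul_div, le_div_iff₀ (by positivity)]
  have m2 : (r1 ^ 2 / 2 - r ^ 2 / 2) * (8 * (lam * N)) ≤
      R * (r + r1) * (4 * (lam * N) * Δ) := by
    have := mul_le_mul_of_nonneg_right k1 (show 0 ≤ 8 * (lam * N) by positivity)
    linarith
  have m3 := mul_le_mul_of_nonneg_left m1 (show 0 ≤ R * (r + r1) by positivity)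
  -- With `u = r + r1` and `v = s + s1`: `u² + u v ≤ 3/2 u² + 1/2 v²`, then `(x + y)² ≤ 2 (x² +
  -- y²)`. This is the origin of the weights `6` and `2`.
  have m4 : (r + r1) * (r + r1 + s + s1) ≤
      6 * (r ^ 2 / 2 + r1 ^ 2 / 2) + 2 * (s ^ 2 / 2 + s1 ^ 2 / 2) := by
    nlinarith [sq_nonneg (r + r1 - (s + s1)), sq_nonneg (r - r1), sq_nonneg (s - s1)]
  have m5 := mul_le_mul_of_nonneg_left m4 (sq_nonneg R)
  linarith

/-! ### Measurability and integrability of the losses of the ridge solution. -/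

section Expectation

variable [MeasurableSpace X] [Countable X] [MeasurableSingletonClass X]

lemma measurable_sqLoss (φ : X → H) (w : H) : Measurable (sqLoss φ w) :=
  ((measurable_snd.sub ((measurable_of_countable fun x => inner ℝ w (φ x)).comp
    measurable_fst)).pow_const 2).div_const 2

/-- The predictions of the ridge solution depend measurably on the training data. -/
lemma measurable_inner_ridge {φ : X → H} {lam Bsq R : ℝ} {N : ℕ} (hlam : 0 < lam) (hR0 : 0 ≤ R)
    (hR : ∀ x, ‖φ x‖ ≤ R) {wstar : (Fin N → X × ℝ) → H}
    (hw : ∀ Z, IsRidgeSolution φ lam Bsq Z (wstar Z)) (x : X) :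
    Measurable fun Z => inner ℝ (wstar Z) (φ x) := by
  have h : Measurable fun q : (Fin N → X) × (Fin N → ℝ) =>
      inner ℝ (wstar fun i => (q.1 i, q.2 i)) (φ x) := by
    -- The inputs range over a countable space, so it is enough to fix them and vary the labels, in
    -- which the solution is Lipschitz.
    refine measurable_from_prod_countable_right fun a => Continuous.measurable ?_
    have hL : LipschitzWith (Real.toNNReal (R / (2 * lam)))
        fun y : Fin N → ℝ => wstar fun i => (a i, y i) := by
      refine LipschitzWith.of_dist_le_mul fun y y' => ?_
      have := (hw fun i => (a i, y' i)).norm_sub_le hR0 hR (hw fun i => (a i, y i))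
        (fun _ => rfl) dist_nonneg (fun i => (dist_le_pi_dist y' y i))
      rw [dist_eq_norm, Real.coe_toNNReal _ (by positivity), div_mul_eq_mul_div,
        le_div_iff₀ (by positivity), dist_comm y]
      linarith
    exact hL.continuous.inner continuous_const
  exact h.comp (MeasurableEquiv.arrowProdEquivProdArrow X ℝ (Fin N)).measurable

lemma measurable_sqLoss_ridge {φ : X → H} {lam Bsq R : ℝ} {N : ℕ} (hlam : 0 < lam) (hR0 : 0 ≤ R)
    (hR : ∀ x, ‖φ x‖ ≤ R) {wstar : (Fin N → X × ℝ) → H}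
    (hw : ∀ Z, IsRidgeSolution φ lam Bsq Z (wstar Z)) :
    Measurable fun q : (X × ℝ) × (Fin N → X × ℝ) => sqLoss φ (wstar q.2) q.1 := by
  have h : Measurable fun q : X × (Fin N → X × ℝ) => inner ℝ (wstar q.2) (φ q.1) :=
    measurable_from_prod_countable_right fun x => measurable_inner_ridge hlam hR0 hR hw x
  exact (((measurable_snd.comp measurable_fst).sub
    (h.comp ((measurable_fst.comp measurable_fst).prodMk measurable_snd))).pow_const 2).div_const 2

lemma sqLoss_le {φ : X → H} {R G B : ℝ} (hR : ∀ x, ‖φ x‖ ≤ R) (hB : 0 ≤ B) {w : H}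
    (hw : ‖w‖ ≤ B) {z : X × ℝ} (hz : |z.2| ≤ G) : sqLoss φ w z ≤ (G + B * R) ^ 2 / 2 := by
  have h1 : |inner ℝ w (φ z.1)| ≤ B * R := (abs_real_inner_le_norm _ _).trans
    (mul_le_mul hw (hR _) (norm_nonneg _) hB)
  have h2 : |z.2 - inner ℝ w (φ z.1)| ≤ G + B * R := (abs_sub _ _).trans (add_le_add hz h1)
  rw [sqLoss, ← sq_abs]
  gcongr

variable {𝒟 : Measure (X × ℝ)} [IsProbabilityMeasure 𝒟]

lemma integrable_sqLoss {φ : X → H} {R G : ℝ} (hR : ∀ x, ‖φ x‖ ≤ R)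
    (hG : ∀ᵐ z ∂𝒟, |z.2| ≤ G) (w : H) : Integrable (sqLoss φ w) 𝒟 := by
  refine Integrable.of_bound (measurable_sqLoss φ w).aestronglyMeasurable
    ((G + ‖w‖ * R) ^ 2 / 2) ?_
  filter_upwards [hG] with z hz
  rw [Real.norm_of_nonneg (sqLoss_nonneg _ _ _)]
  exact sqLoss_le hR (norm_nonneg w) le_rfl hz

lemma integrable_sqLoss_ridge {φ : X → H} {lam Bsq R G : ℝ} {N : ℕ} (hlam : 0 < lam)
    (hR0 : 0 ≤ R) (hR : ∀ x, ‖φ x‖ ≤ R) (hG : ∀ᵐ z ∂𝒟, |z.2| ≤ G) {wstar : (Fin N → X × ℝ) → H}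
    (hw : ∀ Z, IsRidgeSolution φ lam Bsq Z (wstar Z)) {Ω : Type*} [MeasurableSpace Ω]
    {P : Measure Ω} [IsProbabilityMeasure P] {z : Ω → X × ℝ} {Z : Ω → Fin N → X × ℝ}
    (hz : MeasurePreserving z P 𝒟) (hZ : Measurable Z) :
    Integrable (fun ω => sqLoss φ (wstar (Z ω)) (z ω)) P := by
  refine Integrable.of_bound ((measurable_sqLoss_ridge hlam hR0 hR hw).comp
    (hz.measurable.prodMk hZ)).aestronglyMeasurable ((G + √Bsq * R) ^ 2 / 2) ?_
  filter_upwards [hz.quasiMeasurePreserving.ae hG] with ω hω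
  rw [Real.norm_of_nonneg (sqLoss_nonneg _ _ _)]
  exact sqLoss_le hR (Real.sqrt_nonneg _) (Real.le_sqrt_of_sq_le (hw _).1) hω

/-- Exchangeability of i.i.d. samples, used to swap the test sample with a training sample. -/
lemma measurePreserving_comp_perm (N : ℕ) (σ : Equiv.Perm (Fin N)) :
    MeasurePreserving (fun ω : Fin N → X × ℝ => ω ∘ σ) (Measure.pi fun _ => 𝒟)
      (Measure.pi fun _ => 𝒟) := by
  convert measurePreserving_piCongrLeft (fun _ : Fin N => 𝒟) σ.symm using 1
  ext1 ω
  funext i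
  obtain ⟨j, rfl⟩ := σ.symm.surjective i
  rw [MeasurableEquiv.coe_piCongrLeft, Equiv.piCongrLeft_apply_apply]
  simp

end Expectation

end RidgeRegression

/-! ### Expected loss of ridge regression from stability. -/

section Generalization

variable {X H : Type*} [NormedAddCommGroup H] [InnerProductSpace ℝ H]
  [MeasurableSpace X] [Countable X] [MeasurableSingletonClass X]
  {𝒟 : Measure (X × ℝ)} [IsProbabilityMeasure 𝒟]
  {φ : X → H} {lam Bsq R G : ℝ} {N : ℕ} {wstar : (Fin N → X × ℝ) → H}

lemma integrable_expectedLoss_ridge (hlam : 0 < lam) (hR0 : 0 ≤ R) (hR : ∀ x, ‖φ x‖ ≤ R)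
    (hG : ∀ᵐ z ∂𝒟, |z.2| ≤ G) (hw : ∀ Z, IsRidgeSolution φ lam Bsq Z (wstar Z)) :
    Integrable (fun Z => expectedLoss φ 𝒟 (wstar Z)) (Measure.pi fun _ : Fin N => 𝒟) :=
  (integrable_sqLoss_ridge hlam hR0 hR hG hw (P := 𝒟.prod (Measure.pi fun _ : Fin N => 𝒟))
    measurePreserving_fst measurable_snd).integral_prod_right

/-- Puts test and training data on one space: among `N + 1` independent samples, sample `0` is the
test point and the others are the training set. -/
lemma integral_expectedLoss_ridge (hlam : 0 < lam) (hR0 : 0 ≤ R) (hR : ∀ x, ‖φ x‖ ≤ R)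
    (hG : ∀ᵐ z ∂𝒟, |z.2| ≤ G) (hw : ∀ Z, IsRidgeSolution φ lam Bsq Z (wstar Z)) :
    ∫ ω, sqLoss φ (wstar fun k => ω k.succ) (ω 0) ∂(Measure.pi fun _ : Fin (N + 1) => 𝒟) =
      ∫ Z, expectedLoss φ 𝒟 (wstar Z) ∂(Measure.pi fun _ : Fin N => 𝒟) := by
  have h := (measurePreserving_piFinSuccAbove (fun _ : Fin (N + 1) => 𝒟) 0).integral_comp'
    (fun q : (X × ℝ) × (Fin N → X × ℝ) => sqLoss φ (wstar q.2) q.1)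
  rw [integral_prod_symm _ (integrable_sqLoss_ridge hlam hR0 hR hG hw measurePreserving_fst
    measurable_snd)] at h
  exact h

lemma measurePreserving_tail (N : ℕ) :
    MeasurePreserving (fun (ω : Fin (N + 1) → X × ℝ) k => ω (Fin.succ k))
      (Measure.pi fun _ => 𝒟) (Measure.pi fun _ => 𝒟) :=
  measurePreserving_snd.comp (measurePreserving_piFinSuccAbove (fun _ : Fin (N + 1) => 𝒟) 0)

lemma integrable_trainLoss (hlam : 0 < lam) (hR0 : 0 ≤ R) (hR : ∀ x, ‖φ x‖ ≤ R)
    (hG : ∀ᵐ z ∂𝒟, |z.2| ≤ G) (hw : ∀ Z, IsRidgeSolution φ lam Bsq Z (wstar Z)) (i : Fin N) :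
    Integrable (fun Z => sqLoss φ (wstar Z) (Z i)) (Measure.pi fun _ : Fin N => 𝒟) :=
  integrable_sqLoss_ridge hlam hR0 hR hG hw (measurePreserving_eval (fun _ : Fin N => 𝒟) i)
    measurable_id

/-- Stability of ridge regression: the expected loss is close to the expected training loss at
any one sample. -/
lemma integral_expectedLoss_sub_le (hlam : 0 < lam) (hR0 : 0 ≤ R) (hR : ∀ x, ‖φ x‖ ≤ R)
    (hG : ∀ᵐ z ∂𝒟, |z.2| ≤ G) (hw : ∀ Z, IsRidgeSolution φ lam Bsq Z (wstar Z)) (i : Fin N) :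
    ∫ Z, expectedLoss φ 𝒟 (wstar Z) ∂(Measure.pi fun _ : Fin N => 𝒟) -
        ∫ Z, sqLoss φ (wstar Z) (Z i) ∂(Measure.pi fun _ : Fin N => 𝒟) ≤
      R ^ 2 / (lam * N) * (∫ Z, expectedLoss φ 𝒟 (wstar Z) ∂(Measure.pi fun _ : Fin N => 𝒟) +
        ∫ Z, sqLoss φ (wstar Z) (Z i) ∂(Measure.pi fun _ : Fin N => 𝒟)) := by
  set σ : Equiv.Perm (Fin (N + 1)) := Equiv.swap 0 i.succ
  set ν := Measure.pi fun _ : Fin (N + 1) => 𝒟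
  have hσ : MeasurePreserving (fun ω : Fin (N + 1) → X × ℝ => ω ∘ σ) ν ν :=
    measurePreserving_comp_perm (N + 1) σ
  set test : (Fin (N + 1) → X × ℝ) → ℝ := fun ω => sqLoss φ (wstar fun k => ω k.succ) (ω 0)
  set train : (Fin (N + 1) → X × ℝ) → ℝ := fun ω => sqLoss φ (wstar fun k => ω k.succ) (ω i.succ)
  have htail := measurePreserving_tail (𝒟 := 𝒟) N
  have itest : Integrable test ν := integrable_sqLoss_ridge hlam hR0 hR hG hw
    (measurePreserving_eval (fun _ : Fin (N + 1) => 𝒟) 0) htail.measurable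
  have itrain : Integrable train ν := integrable_sqLoss_ridge hlam hR0 hR hG hw
    (measurePreserving_eval (fun _ : Fin (N + 1) => 𝒟) i.succ) htail.measurable
  have etest : ∫ ω, test ω ∂ν = _ := integral_expectedLoss_ridge hlam hR0 hR hG hw
  have etrain : ∫ ω, train ω ∂ν =
      ∫ Z, sqLoss φ (wstar Z) (Z i) ∂(Measure.pi fun _ : Fin N => 𝒟) := by
    rw [← htail.map_eq, integral_map htail.measurable.aemeasurable]
    rw [htail.map_eq]
    exact (integrable_trainLoss hlam hR0 hR hG hw i).aestronglyMeasurable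
  have comp (f : (Fin (N + 1) → X × ℝ) → ℝ) (hf : Integrable f ν) :
      ∫ ω, f (ω ∘ σ) ∂ν = ∫ ω, f ω ∂ν := by
    conv_rhs => rw [← hσ.map_eq]
    rw [integral_map hσ.measurable.aemeasurable]
    rw [hσ.map_eq]
    exact hf.aestronglyMeasurable
  have jtest : Integrable (fun ω => test (ω ∘ σ)) ν := hσ.integrable_comp_of_integrable itest
  have jtrain : Integrable (fun ω => train (ω ∘ σ)) ν := hσ.integrable_comp_of_integrable itrain
  -- After the swap, the test point is the old `i`-th training point and the training set has the
  -- old test point in its place. The two training sets differ in one sample, so the stability bound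
  -- applies; on integration the swap is invisible and the weights add up to `8`.
  have pointwise (ω : Fin (N + 1) → X × ℝ) : test (ω ∘ σ) - train ω ≤ R ^ 2 / (8 * (lam * N)) *
      (6 * (train ω + test (ω ∘ σ)) + 2 * (train (ω ∘ σ) + test ω)) := by
    have h := (hw fun k => ω k.succ).sqLoss_sub_le hlam hR (hw fun k => (ω ∘ σ) k.succ)
      (i := i) fun j hj => by
        simp only [Function.comp_apply, σ]
        rw [Equiv.swap_apply_of_ne_of_ne (Fin.succ_ne_zero j) (by simpa using hj)]
    simpa [test, train, σ] using h
  have hint := integral_mono (jtest.sub itrain)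
    ((((itrain.add jtest).const_mul 6).add ((jtrain.add itest).const_mul 2)).const_mul _)
    pointwise
  have hsum : ∫ ω, (6 * (train ω + test (ω ∘ σ)) + 2 * (train (ω ∘ σ) + test ω)) ∂ν =
      6 * (∫ ω, train ω ∂ν + ∫ ω, test ω ∂ν) + 2 * (∫ ω, train ω ∂ν + ∫ ω, test ω ∂ν) := by
    have i1 : Integrable (fun ω => 6 * (train ω + test (ω ∘ σ))) ν := (itrain.add jtest).const_mul 6
    have i2 : Integrable (fun ω => 2 * (train (ω ∘ σ) + test ω)) ν := (jtrain.add itest).const_mul 2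
    rw [integral_add i1 i2, integral_const_mul, integral_const_mul, integral_add itrain jtest, integral_add jtrain itest,
      comp _ itest, comp _ itrain]
  simp only [Pi.add_apply, Pi.sub_apply] at hint
  rw [integral_sub jtest itrain, integral_const_mul, hsum, comp _ itest, etest, etrain] at hint
  refine hint.trans (le_of_eq ?_)
  rw [mul_comm (8 : ℝ), ← div_div]
  ring

lemma integral_empiricalLoss (hlam : 0 < lam) (hR0 : 0 ≤ R) (hR : ∀ x, ‖φ x‖ ≤ R)
    (hG : ∀ᵐ z ∂𝒟, |z.2| ≤ G) (hw : ∀ Z, IsRidgeSolution φ lam Bsq Z (wstar Z)) :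
    ∫ Z, empiricalLoss φ Z (wstar Z) ∂(Measure.pi fun _ : Fin N => 𝒟) =
      (N : ℝ)⁻¹ * ∑ i, ∫ Z, sqLoss φ (wstar Z) (Z i) ∂(Measure.pi fun _ : Fin N => 𝒟) := by
  simp only [empiricalLoss]
  rw [integral_const_mul, integral_finsetSum _ fun i _ =>
    integrable_trainLoss hlam hR0 hR hG hw i]

lemma integrable_empiricalLoss_const (hR : ∀ x, ‖φ x‖ ≤ R) (hG : ∀ᵐ z ∂𝒟, |z.2| ≤ G) (w : H) :
    Integrable (fun Z => empiricalLoss φ Z w) (Measure.pi fun _ : Fin N => 𝒟) :=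
  Integrable.const_mul (integrable_finsetSum _ fun i _ =>
    (measurePreserving_eval (fun _ : Fin N => 𝒟) i).integrable_comp_of_integrable
      (integrable_sqLoss hR hG w)) _

lemma integral_empiricalLoss_const (hN : 0 < N) (hR : ∀ x, ‖φ x‖ ≤ R)
    (hG : ∀ᵐ z ∂𝒟, |z.2| ≤ G) (w : H) :
    ∫ Z, empiricalLoss φ Z w ∂(Measure.pi fun _ : Fin N => 𝒟) = expectedLoss φ 𝒟 w := by
  have hi (i : Fin N) : MeasurePreserving (fun Z : Fin N → X × ℝ => Z i)
      (Measure.pi fun _ => 𝒟) 𝒟 := measurePreserving_eval (fun _ : Fin N => 𝒟) i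
  have e (i : Fin N) : ∫ Z, sqLoss φ w (Z i) ∂(Measure.pi fun _ : Fin N => 𝒟) =
      expectedLoss φ 𝒟 w := by
    have h := integral_map (μ := Measure.pi fun _ : Fin N => 𝒟) (hi i).measurable.aemeasurable
      (measurable_sqLoss φ w).aestronglyMeasurable
    rw [(hi i).map_eq] at h
    exact h.symm
  have hint (i : Fin N) : Integrable (fun Z : Fin N → X × ℝ => sqLoss φ w (Z i))
      (Measure.pi fun _ => 𝒟) :=
    (hi i).integrable_comp_of_integrable (integrable_sqLoss hR hG w)
  simp only [empiricalLoss]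
  rw [integral_const_mul, integral_finsetSum _ fun i _ => hint i]
  simp only [e, Finset.sum_const, Finset.card_univ, Fintype.card_fin, nsmul_eq_mul]
  rw [inv_mul_cancel_left₀ (Nat.cast_ne_zero.2 hN.ne')]

/-- The expected regularised training loss is at most that of any fixed competitor. -/
lemma integral_empiricalLoss_ridge_le (hlam : 0 < lam) (hN : 0 < N) (hR0 : 0 ≤ R)
    (hR : ∀ x, ‖φ x‖ ≤ R) (hG : ∀ᵐ z ∂𝒟, |z.2| ≤ G)
    (hw : ∀ Z, IsRidgeSolution φ lam Bsq Z (wstar Z)) {w : H} (hwB : ‖w‖ ^ 2 ≤ Bsq) :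
    ∫ Z, empiricalLoss φ Z (wstar Z) ∂(Measure.pi fun _ : Fin N => 𝒟) ≤
      expectedLoss φ 𝒟 w + lam * ‖w‖ ^ 2 := by
  have h1 : Integrable (fun Z => empiricalLoss φ Z (wstar Z)) (Measure.pi fun _ : Fin N => 𝒟) :=
    Integrable.const_mul (integrable_finsetSum _ fun i _ =>
      integrable_trainLoss hlam hR0 hR hG hw i) _
  have h2 := integrable_empiricalLoss_const (N := N) hR hG w
  have := integral_mono h1 (h2.add (integrable_const (lam * ‖w‖ ^ 2))) fun Z => by
    have := (hw Z).2 w hwB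
    have h3 : 0 ≤ lam * ‖wstar Z‖ ^ 2 := by positivity
    simp only [Pi.add_apply]
    linarith
  refine this.trans (le_of_eq ?_)
  simp only [Pi.add_apply]
  rw [integral_add h2 (integrable_const _), integral_empiricalLoss_const hN hR hG]
  simp

/-- The expected loss of constrained kernel ridge regression with `N` samples. -/
theorem integral_expectedLoss_ridge_le (hlam : 0 < lam) (hN : 0 < N) (hR0 : 0 ≤ R)
    (hR : ∀ x, ‖φ x‖ ≤ R) (hG : ∀ᵐ z ∂𝒟, |z.2| ≤ G)
    (hw : ∀ Z, IsRidgeSolution φ lam Bsq Z (wstar Z)) {w : H} (hwB : ‖w‖ ^ 2 ≤ Bsq)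
    (hκ : 2 * R ^ 2 ≤ lam * N) :
    ∫ Z, expectedLoss φ 𝒟 (wstar Z) ∂(Measure.pi fun _ : Fin N => 𝒟) ≤
      expectedLoss φ 𝒟 w + lam * Bsq + 2 * (R ^ 2 / (lam * N)) * G ^ 2 := by
  have hN' : (0 : ℝ) < N := Nat.cast_pos.2 hN
  set b := ∫ Z, expectedLoss φ 𝒟 (wstar Z) ∂(Measure.pi fun _ : Fin N => 𝒟) with hb
  set a := ∫ Z, empiricalLoss φ Z (wstar Z) ∂(Measure.pi fun _ : Fin N => 𝒟)
  set κ := R ^ 2 / (lam * N)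
  have hκ0 : 0 ≤ κ := by positivity
  have hκ2 : κ ≤ 1 / 2 := by
    rw [div_le_div_iff₀ (by positivity) (by norm_num)]
    linarith
  have stab : b - a ≤ κ * (b + a) := by
    have hs := Finset.sum_le_sum fun i (_ : i ∈ (Finset.univ : Finset (Fin N))) =>
      integral_expectedLoss_sub_le hlam hR0 hR hG hw i
    rw [Finset.sum_sub_distrib, ← Finset.mul_sum, Finset.sum_add_distrib] at hs
    have := mul_le_mul_of_nonneg_left hs (inv_nonneg.2 hN'.le)
    simp only [Finset.sum_const, Finset.card_univ, Fintype.card_fin, nsmul_eq_mul, ← hb] at this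
    rw [mul_left_comm, mul_sub, mul_add, inv_mul_cancel_left₀ hN'.ne',
      ← integral_empiricalLoss hlam hR0 hR hG hw] at this
    exact this
  have hG0 : 0 ≤ G := by
    obtain ⟨z, hz⟩ := hG.exists
    exact (abs_nonneg _).trans hz
  have a0 : 0 ≤ a := integral_nonneg fun Z => empiricalLoss_nonneg _ _ _
  have hB0 : 0 ≤ Bsq := (sq_nonneg _).trans hwB
  have a1 : a ≤ expectedLoss φ 𝒟 w + lam * Bsq :=
    (integral_empiricalLoss_ridge_le hlam hN hR0 hR hG hw hwB).trans (by gcongr)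
  -- The competitor `0` gives a bound on the training loss that involves only the size of the
  -- labels.
  have a2 : a ≤ G ^ 2 / 2 := by
    have h0 := integral_empiricalLoss_ridge_le hlam hN hR0 hR hG hw (w := 0) (by simpa using hB0)
    have h1 : expectedLoss φ 𝒟 (0 : H) ≤ ∫ _, G ^ 2 / 2 ∂𝒟 := by
      refine integral_mono_ae (integrable_sqLoss hR hG 0) (integrable_const _) ?_
      filter_upwards [hG] with z hz
      simpa using sqLoss_le hR le_rfl (norm_zero (E := H)).le hz
    simp at h0 h1
    linarith
  -- From `(1 - κ) b ≤ (1 + κ) a` and `κ ≤ 1/2` follows `b ≤ a + 4 κ a`; bound the first `a` by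
  -- `a1`, the second by `a2`.
  nlinarith [mul_le_mul_of_nonneg_left a2 hκ0, mul_nonneg hκ0 a0]

end Generalization

/-! ### Unbiased single-shot estimators of Pauli strings. -/

section PauliEstimators

variable {κ : Type*} [Fintype κ] [DecidableEq κ] {T : ℕ}

/-- The estimate of the expectation value of a Pauli string from a single shot. -/
def shotEstimator (P : κ → Fin 4) (x : Shot κ) : ℝ :=
  ∏ k, (pauli (P k) * localShadow (x k)).trace.re

/-- The estimate of the expectation value of a Pauli string from a classical shadow. -/
def shadowEstimator (P : κ → Fin 4) (s : Shadow κ T) : ℝ :=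
  (T : ℝ)⁻¹ * ∑ t, shotEstimator P (s t)

lemma trace_pauli_zero_localShadow (x : Fin 3 × Fin 2) :
    (pauli 0 * localShadow x).trace.re = 1 := by
  simp [trace_pauli_localShadow]

lemma abs_trace_pauli_localShadow_le (P : Fin 4) (x : Fin 3 × Fin 2) :
    |(pauli P * localShadow x).trace.re| ≤ if P ≠ 0 then 3 else 1 := by
  rw [trace_pauli_localShadow, Complex.ofReal_re]
  split_ifs <;> simp_all [abs_mul]

lemma abs_shotEstimator_le (P : κ → Fin 4) (x : Shot κ) :
    |shotEstimator P x| ≤ 3 ^ pauliWeight P := by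
  rw [shotEstimator, Finset.abs_prod]
  refine (Finset.prod_le_prod (fun _ _ => abs_nonneg _) fun k _ =>
    abs_trace_pauli_localShadow_le (P k) (x k)).trans (le_of_eq ?_)
  rw [Finset.prod_ite, Finset.prod_const, Finset.prod_const_one, mul_one, pauliWeight]

/-- For the identity letter the projections of each of the three bases sum to `1`; for any other
letter only its own basis contributes, with weights `±3`. The factor `3` cancels the probability
`1/3` of a basis. -/
lemma sum_trace_pauli_smul_outcomeProj (P : Fin 4) :
    ∑ x, (((pauli P * localShadow x).trace.re : ℝ) : ℂ) • outcomeProj x = (3 : ℂ) • pauli P := by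
  simp only [trace_pauli_localShadow, Complex.ofReal_re]
  ext a b
  simp only [Matrix.sum_apply, Matrix.smul_apply, Fintype.sum_prod_type, Fin.sum_univ_two,
    Fin.sum_univ_three]
  fin_cases P <;> fin_cases a <;> fin_cases b <;>
    simp [outcomeProj, signedPauli, pauli, Matrix.one_fin_two] <;> ring_nf

/-- The single-shot estimator is unbiased. -/
lemma sum_shotProb_mul_shotEstimator (ρ : QState κ) (P : κ → Fin 4) :
    ∑ x, shotProb ρ x * shotEstimator P x = (ρ.expect (pauliString P)).re := by
  have h : ∑ x : Shot κ, ((shotEstimator P x : ℝ) : ℂ) • tensor (fun k => outcomeProj (x k)) =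
      ((3 ^ Fintype.card κ : ℝ) : ℂ) • pauliString P := by
    ext a b
    have h1 := Finset.prod_univ_sum (fun _ : κ => (Finset.univ : Finset (Fin 3 × Fin 2)))
      (fun k x => (((pauli (P k) * localShadow x).trace.re : ℝ) : ℂ) * outcomeProj x (a k) (b k))
    rw [Fintype.piFinset_univ] at h1
    have h2 (k : κ) : ∑ x, (((pauli (P k) * localShadow x).trace.re : ℝ) : ℂ) *
        outcomeProj x (a k) (b k) = 3 * pauli (P k) (a k) (b k) := by
      have := congrFun (congrFun (sum_trace_pauli_smul_outcomeProj (P k)) (a k)) (b k)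
      simpa [Matrix.sum_apply] using this
    simp only [h2, Finset.prod_mul_distrib, Finset.prod_const, Finset.card_univ] at h1
    simp only [Matrix.sum_apply, tensor, pauliString, Matrix.of_apply, Matrix.smul_apply,
      shotEstimator, smul_eq_mul, Complex.ofReal_prod, Complex.ofReal_pow, Complex.ofReal_ofNat]
    exact h1.symm
  have h3 (x : Shot κ) : shotProb ρ x * shotEstimator P x = (1 / 3 : ℝ) ^ Fintype.card κ *
      (ρ.expect (((shotEstimator P x : ℝ) : ℂ) • tensor fun k => outcomeProj (x k))).re := by
    rw [shotProb, QState.expect, QState.expect, Matrix.smul_mul, Matrix.trace_smul, smul_eq_mul,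
      Complex.re_ofReal_mul]
    ring
  simp only [h3, ← Finset.mul_sum, ← Complex.re_sum, QState.expect, ← Matrix.trace_sum,
    ← Matrix.sum_mul, h]
  rw [Matrix.smul_mul, Matrix.trace_smul, smul_eq_mul, Complex.re_ofReal_mul, ← mul_assoc,
    ← mul_pow]
  norm_num

lemma pauli_conjTranspose (P : Fin 4) : (pauli P).conjTranspose = pauli P := by
  ext a b
  fin_cases P <;> fin_cases a <;> fin_cases b <;> simp [pauli, Matrix.one_fin_two]

lemma pauli_mul_self (P : Fin 4) : pauli P * pauli P = 1 := by
  ext a b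
  fin_cases P <;> fin_cases a <;> fin_cases b <;> simp [pauli, Matrix.one_fin_two]

lemma tensor_one : tensor (fun _ : κ => (1 : Matrix (Fin 2) (Fin 2) ℂ)) = 1 := by
  ext a b
  by_cases hab : a = b
  · subst hab
    simp [tensor]
  · obtain ⟨k, hk⟩ := Function.ne_iff.1 hab
    rw [Matrix.one_apply_ne hab, tensor, Matrix.of_apply]
    exact Finset.prod_eq_zero (Finset.mem_univ k) (Matrix.one_apply_ne hk)

lemma expect_conjTranspose_mul_self_re_nonneg (ρ : QState κ)
    (M : Matrix (κ → Fin 2) (κ → Fin 2) ℂ) : 0 ≤ (ρ.expect (M.conjTranspose * M)).re := by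
  rw [QState.expect, Matrix.mul_assoc, Matrix.trace_mul_comm]
  exact (Complex.le_def.1 (ρ.posSemidef.mul_mul_conjTranspose_same M).trace_nonneg).1

/-- Expectation values of Pauli strings lie between `-1` and `1`. -/
lemma abs_expect_pauliString_re_le (ρ : QState κ) (P : κ → Fin 4) :
    |(ρ.expect (pauliString P)).re| ≤ 1 := by
  have hc : (pauliString P).conjTranspose = pauliString P := by
    simp only [pauliString, tensor_conjTranspose, pauli_conjTranspose]
  have hm : pauliString P * pauliString P = 1 := by
    simp only [pauliString, tensor_mul, pauli_mul_self, tensor_one]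
  have h1 : ρ.expect 1 = 1 := by rw [QState.expect, Matrix.one_mul, ρ.trace_eq_one]
  have hadd (A B : Matrix (κ → Fin 2) (κ → Fin 2) ℂ) :
      ρ.expect (A + B) = ρ.expect A + ρ.expect B := by
    simp only [QState.expect, Matrix.add_mul, Matrix.trace_add]
  have hsub (A B : Matrix (κ → Fin 2) (κ → Fin 2) ℂ) :
      ρ.expect (A - B) = ρ.expect A - ρ.expect B := by
    simp only [QState.expect, Matrix.sub_mul, Matrix.trace_sub]
  -- Since a Pauli string squares to `1`, `(1 ± P)² = 2 (1 ± P)`; positivity of the state gives both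
  -- bounds.
  have p := expect_conjTranspose_mul_self_re_nonneg ρ (1 + pauliString P)
  have q := expect_conjTranspose_mul_self_re_nonneg ρ (1 - pauliString P)
  rw [Matrix.conjTranspose_add, Matrix.conjTranspose_one, hc, Matrix.mul_add, Matrix.add_mul,
    Matrix.add_mul, hm, Matrix.one_mul, Matrix.one_mul, Matrix.mul_one] at p
  rw [Matrix.conjTranspose_sub, Matrix.conjTranspose_one, hc, Matrix.mul_sub, Matrix.sub_mul,
    Matrix.sub_mul, hm, Matrix.one_mul, Matrix.one_mul, Matrix.mul_one] at q
  simp only [hadd, hsub, h1, Complex.add_re, Complex.sub_re, Complex.one_re] at p q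
  rw [abs_le]
  constructor <;> linarith

lemma StatePoly.abs_eval_le {p : ℕ} (g : StatePoly κ p) (ρ : QState κ) :
    |g.eval ρ| ≤ g.l1norm := by
  refine (Finset.abs_sum_le_sum_abs _ _).trans (Finset.sum_le_sum fun i _ => ?_)
  rw [abs_mul, Finset.abs_prod]
  exact mul_le_of_le_one_right (abs_nonneg _) (Finset.prod_le_one (fun _ _ => abs_nonneg _)
    fun j _ => abs_expect_pauliString_re_le ρ _)

end PauliEstimators

/-! ### Independence of the rounds and Hoeffding concentration. -/

section ShadowLaw

variable {κ : Type*} [Fintype κ] [DecidableEq κ] {T : ℕ}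

/-- The law of a single shot. -/
def shotLaw (ρ : QState κ) : Measure (Shot κ) :=
  ∑ x : Shot κ, ENNReal.ofReal (shotProb ρ x) • Measure.dirac x

lemma shotLaw_singleton (ρ : QState κ) (x : Shot κ) :
    shotLaw ρ {x} = ENNReal.ofReal (shotProb ρ x) := by
  simp [shotLaw, Set.indicator_apply]

lemma shadowLaw_singleton (ρ : QState κ) (s : Shadow κ T) :
    shadowLaw T ρ {s} = ENNReal.ofReal (∏ t, shotProb ρ (s t)) := by
  simp [shadowLaw, Set.indicator_apply]

instance (ρ : QState κ) : IsProbabilityMeasure (shotLaw ρ) := by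
  constructor
  simp only [shotLaw, Measure.coe_finsetSum, Finset.sum_apply, Measure.smul_apply,
    measure_univ, smul_eq_mul, mul_one]
  rw [← ENNReal.ofReal_sum_of_nonneg fun x _ => shotProb_nonneg ρ x, sum_shotProb]
  simp

lemma shadowLaw_eq_pi (ρ : QState κ) :
    shadowLaw T ρ = Measure.pi fun _ : Fin T => shotLaw ρ := by
  refine Measure.ext_of_singleton fun s => ?_
  rw [shadowLaw_singleton, Measure.pi_singleton,
    ENNReal.ofReal_prod_of_nonneg fun t _ => shotProb_nonneg ρ (s t)]
  simp only [shotLaw_singleton]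

lemma integral_shotLaw (ρ : QState κ) (f : Shot κ → ℝ) :
    ∫ x, f x ∂(shotLaw ρ) = ∑ x, shotProb ρ x * f x := by
  rw [integral_fintype Integrable.of_finite]
  simp only [Measure.real, shotLaw_singleton, smul_eq_mul,
    ENNReal.toReal_ofReal (shotProb_nonneg ρ _)]

open ProbabilityTheory in
/-- Concentration of the shadow estimator of a Pauli string, from above. -/
lemma shadowLaw_real_mul_sub_ge_le (ρ : QState κ) {P : κ → Fin 4} {m : ℕ}
    (hP : pauliWeight P ≤ m) (hT : 0 < T) {η : ℝ} (hη : 0 ≤ η) {c : ℝ} (hc : c = 1 ∨ c = -1) :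
    (shadowLaw T ρ).real
        {s | η ≤ c * (shadowEstimator P s - (ρ.expect (pauliString P)).re)} ≤
      Real.exp (-(T * η ^ 2 / (2 * 9 ^ m))) := by
  have hT' : (0 : ℝ) < T := Nat.cast_pos.2 hT
  set f : Shot κ → ℝ := fun x => c * shotEstimator P x
  have hf (x : Shot κ) : f x ∈ Set.Icc (-3 ^ m : ℝ) (3 ^ m) := by
    rw [Set.mem_Icc, ← abs_le, abs_mul, show |c| = 1 by rcases hc with h | h <;> simp [h], one_mul]
    exact (abs_shotEstimator_le P x).trans (pow_le_pow_right₀ (by norm_num) hP)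
  have hmean : ∫ x, f x ∂(shotLaw ρ) = c * (ρ.expect (pauliString P)).re := by
    rw [integral_const_mul, integral_shotLaw, sum_shotProb_mul_shotEstimator]
  -- Hoeffding's lemma on `[-3 ^ m, 3 ^ m]`: half the length squared is the variance proxy `9 ^ m`.
  have hsub : HasSubgaussianMGF (fun x => f x - ∫ x, f x ∂(shotLaw ρ))
      ((‖(3 ^ m : ℝ) - (-3 ^ m)‖₊ / 2) ^ 2) (shotLaw ρ) :=
    hasSubgaussianMGF_of_mem_Icc (measurable_of_finite f).aemeasurable (ae_of_all _ hf)
  rw [hmean] at hsub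
  have hind : iIndepFun (fun (t : Fin T) (s : Shadow κ T) =>
      f (s t) - c * (ρ.expect (pauliString P)).re) (shadowLaw T ρ) := by
    rw [shadowLaw_eq_pi]
    exact iIndepFun_pi (μ := fun _ : Fin T => shotLaw ρ)
      (X := fun _ x => f x - c * (ρ.expect (pauliString P)).re)
      fun _ => (measurable_of_finite _).aemeasurable
  have hsub' (t : Fin T) : HasSubgaussianMGF (fun s : Shadow κ T =>
      f (s t) - c * (ρ.expect (pauliString P)).re)
      ((‖(3 ^ m : ℝ) - (-3 ^ m)‖₊ / 2) ^ 2) (shadowLaw T ρ) := by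
    have hp : MeasurePreserving (fun s : Shadow κ T => s t) (shadowLaw T ρ) (shotLaw ρ) := by
      rw [shadowLaw_eq_pi]
      exact measurePreserving_eval (fun _ : Fin T => shotLaw ρ) t
    rw [← hp.map_eq] at hsub
    exact HasSubgaussianMGF.of_map hp.measurable.aemeasurable hsub
  have h := HasSubgaussianMGF.measure_sum_ge_le_of_iIndepFun hind (s := Finset.univ)
    (fun t _ => hsub' t) (show 0 ≤ T * η by positivity)
  refine le_of_eq_of_le ?_ (h.trans (le_of_eq ?_))
  · congr 1
    ext s
    simp only [Set.mem_ofPred_eq, f, Finset.sum_sub_distrib, ← Finset.mul_sum, Finset.sum_const,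
      Finset.card_univ, Fintype.card_fin, nsmul_eq_mul, shadowEstimator]
    rw [show c * ∑ t, shotEstimator P (s t) - c * (T * (ρ.expect (pauliString P)).re) =
      T * (c * ((T : ℝ)⁻¹ * ∑ t, shotEstimator P (s t) - (ρ.expect (pauliString P)).re)) by
      field_simp]
    exact (mul_le_mul_iff_right₀ hT').symm
  · congr 1
    have e : ((‖(3 ^ m : ℝ) - (-3 ^ m)‖₊ / 2) ^ 2 : NNReal) = ((9 : NNReal) ^ m) := by
      apply NNReal.eq
      push_cast
      rw [sub_neg_eq_add, ← two_mul, Real.norm_of_nonneg (by positivity),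
        mul_div_cancel_left₀ _ (by norm_num), ← pow_mul, mul_comm, pow_mul]
      norm_num
    rw [e]
    push_cast
    simp only [Finset.sum_const, Finset.card_univ, Fintype.card_fin, nsmul_eq_mul]
    field_simp

end ShadowLaw

/-- Exchange one factor at a time: the induction closes because `(1 + η) ((1 + η) ^ k - 1) + η = (1
+ η) ^ (k + 1) - 1`. -/
lemma abs_prod_sub_prod_le {ι : Type*} (s : Finset ι) {a b : ι → ℝ} {η : ℝ} (hη : 0 ≤ η)
    (ha : ∀ j, |a j| ≤ 1) (hab : ∀ j, |b j - a j| ≤ η) :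
    |∏ j ∈ s, b j - ∏ j ∈ s, a j| ≤ (1 + η) ^ s.card - 1 := by
  classical
  induction s using Finset.induction_on with
  | empty => simp
  | insert i s hi ih =>
    have hb : |b i| ≤ 1 + η := by
      have := abs_add_le (a i) (b i - a i)
      rw [add_sub_cancel] at this
      linarith [ha i, hab i]
    have hp : |∏ j ∈ s, a j| ≤ 1 := by
      rw [Finset.abs_prod]
      exact Finset.prod_le_one (fun _ _ => abs_nonneg _) fun j _ => ha j
    rw [Finset.prod_insert hi, Finset.prod_insert hi, Finset.card_insert_of_notMem hi,
      show b i * ∏ j ∈ s, b j - a i * ∏ j ∈ s, a j =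
        b i * (∏ j ∈ s, b j - ∏ j ∈ s, a j) + (b i - a i) * ∏ j ∈ s, a j by ring]
    refine (abs_add_le _ _).trans ?_
    rw [abs_mul, abs_mul]
    have h1 := mul_le_mul hb ih (abs_nonneg _) (by positivity)
    have h2 := mul_le_mul (hab i) hp (abs_nonneg _) hη
    rw [pow_succ]
    linarith

/-! ### Mean square error of the plug-in estimate. -/

section SecondMoment

variable {κ : Type*} [Fintype κ] [DecidableEq κ] {T : ℕ}

lemma abs_shadowEstimator_le {P : κ → Fin 4} {m : ℕ} (hP : pauliWeight P ≤ m) (s : Shadow κ T) :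
    |shadowEstimator P s| ≤ 3 ^ m := by
  have h : |∑ t, shotEstimator P (s t)| ≤ T * 3 ^ m := by
    refine (Finset.abs_sum_le_sum_abs _ _).trans
      ((Finset.sum_le_sum fun t _ => (abs_shotEstimator_le P (s t)).trans
        (pow_le_pow_right₀ (by norm_num) hP)).trans (by simp))
  rw [shadowEstimator, abs_mul, abs_of_nonneg (show (0 : ℝ) ≤ (T : ℝ)⁻¹ by positivity)]
  refine (mul_le_mul_of_nonneg_left h (by positivity)).trans ?_
  rw [← mul_assoc]
  exact mul_le_of_le_one_left (by positivity) inv_mul_le_one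

lemma shadowLaw_real_abs_sub_ge_le (ρ : QState κ) {P : κ → Fin 4} {m : ℕ}
    (hP : pauliWeight P ≤ m) (hT : 0 < T) {η : ℝ} (hη : 0 ≤ η) :
    (shadowLaw T ρ).real {s | η ≤ |shadowEstimator P s - (ρ.expect (pauliString P)).re|} ≤
      2 * Real.exp (-(T * η ^ 2 / (2 * 9 ^ m))) := by
  have h1 := shadowLaw_real_mul_sub_ge_le ρ hP hT hη (c := 1) (Or.inl rfl)
  have h2 := shadowLaw_real_mul_sub_ge_le ρ hP hT hη (c := -1) (Or.inr rfl)
  rw [two_mul]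
  refine (measureReal_mono ?_).trans ((measureReal_union_le _ _).trans (add_le_add h1 h2))
  intro s hs
  rcases le_abs.1 (show η ≤ |_| from hs) with h | h
  · exact Or.inl (by simpa using h)
  · exact Or.inr (by simpa using h)

/-- The mean square error of a product of shadow estimators. -/
lemma integral_sq_prod_sub_prod_le (ρ : QState κ) {p m : ℕ} {P : Fin p → κ → Fin 4}
    (hP : ∀ j, pauliWeight (P j) ≤ m) (hT : 0 < T) {η : ℝ} (hη : 0 ≤ η) :
    ∫ s : Shadow κ T, (∏ j, (ρ.expect (pauliString (P j))).re - ∏ j, shadowEstimator (P j) s) ^ 2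
        ∂(shadowLaw T ρ) ≤
      ((1 + η) ^ p - 1) ^ 2 +
        (3 ^ (m * p) + 1) ^ 2 * (p * (2 * Real.exp (-(T * η ^ 2 / (2 * 9 ^ m))))) := by
  -- Off the bad events all factors are accurate to `η`; on them the error is bounded trivially by
  -- `3 ^ (m * p) + 1`, and their probabilities are summed.
  set bad : Fin p → Set (Shadow κ T) := fun j =>
    {s | η ≤ |shadowEstimator (P j) s - (ρ.expect (pauliString (P j))).re|}
  have hind (j : Fin p) (s : Shadow κ T) : 0 ≤ (bad j).indicator (fun _ => (1 : ℝ)) s :=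
    Set.indicator_nonneg (fun _ _ => zero_le_one) s
  have hpt (s : Shadow κ T) :
      (∏ j, (ρ.expect (pauliString (P j))).re - ∏ j, shadowEstimator (P j) s) ^ 2 ≤
        ((1 + η) ^ p - 1) ^ 2 +
          (3 ^ (m * p) + 1) ^ 2 * ∑ j, (bad j).indicator (fun _ => (1 : ℝ)) s := by
    rw [← sq_abs, abs_sub_comm]
    by_cases hs : ∃ j, s ∈ bad j
    · obtain ⟨j, hj⟩ := hs
      have h1 : 1 ≤ ∑ j, (bad j).indicator (fun _ => (1 : ℝ)) s := by
        refine le_trans ?_ (Finset.single_le_sum (fun i _ => hind i s) (Finset.mem_univ j))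
        rw [Set.indicator_of_mem hj]
      have h2 : |∏ j, shadowEstimator (P j) s - ∏ j, (ρ.expect (pauliString (P j))).re| ≤
          3 ^ (m * p) + 1 := by
        refine (abs_sub _ _).trans (add_le_add ?_ ?_)
        · rw [Finset.abs_prod, pow_mul]
          refine (Finset.prod_le_prod (fun _ _ => abs_nonneg _) fun j _ =>
            abs_shadowEstimator_le (hP j) s).trans (by simp)
        · rw [Finset.abs_prod]
          exact Finset.prod_le_one (fun _ _ => abs_nonneg _)
            fun j _ => abs_expect_pauliString_re_le ρ _
      have h3 := pow_le_pow_left₀ (abs_nonneg _) h2 2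
      have h4 : ((3 : ℝ) ^ (m * p) + 1) ^ 2 ≤
          (3 ^ (m * p) + 1) ^ 2 * ∑ j, (bad j).indicator (fun _ => (1 : ℝ)) s :=
        le_mul_of_one_le_right (by positivity) h1
      linarith [sq_nonneg ((1 + η) ^ p - 1)]
    · push Not at hs
      have h := abs_prod_sub_prod_le Finset.univ hη
        (fun j => abs_expect_pauliString_re_le ρ (P j))
        (b := fun j => shadowEstimator (P j) s) fun j => (not_le.1 (hs j)).le
      rw [Finset.card_univ, Fintype.card_fin] at h
      have h3 := pow_le_pow_left₀ (abs_nonneg _) h 2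
      have h4 : 0 ≤ ((3 : ℝ) ^ (m * p) + 1) ^ 2 *
          ∑ j, (bad j).indicator (fun _ => (1 : ℝ)) s :=
        mul_nonneg (sq_nonneg _) (Finset.sum_nonneg fun j _ => hind j s)
      linarith
  have hint := integral_mono (μ := shadowLaw T ρ) Integrable.of_finite Integrable.of_finite hpt
  refine hint.trans ?_
  rw [integral_add Integrable.of_finite Integrable.of_finite, integral_const_mul,
    integral_finsetSum _ fun _ _ => Integrable.of_finite, integral_const, probReal_univ, one_smul]
  gcongr
  have hj (j : Fin p) : ∫ s, (bad j).indicator (fun _ => (1 : ℝ)) s ∂(shadowLaw T ρ) ≤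
      2 * Real.exp (-(T * η ^ 2 / (2 * 9 ^ m))) := by
    rw [integral_indicator (Set.toFinite _).measurableSet, setIntegral_const, smul_eq_mul, mul_one]
    exact shadowLaw_real_abs_sub_ge_le ρ (hP j) hT hη
  exact (Finset.sum_le_sum fun j _ => hj j).trans (by simp)

/-- The estimate of `g(ρ)` from a classical shadow. -/
def StatePoly.shadowEval {p : ℕ} (g : StatePoly κ p) (s : Shadow κ T) : ℝ :=
  ∑ i, g.coeff i * ∏ j, shadowEstimator (g.string i j) s

/-- Cauchy–Schwarz with weights `|g.coeff i|`, so that the number of terms of `g` does not enter. -/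
lemma integral_sq_eval_sub_shadowEval_le {p : ℕ} (g : StatePoly κ p) (ρ : QState κ) {c : ℝ}
    (hc : ∀ i, ∫ s : Shadow κ T, (∏ j, (ρ.expect (pauliString (g.string i j))).re -
      ∏ j, shadowEstimator (g.string i j) s) ^ 2 ∂(shadowLaw T ρ) ≤ c) :
    ∫ s : Shadow κ T, (g.eval ρ - g.shadowEval s) ^ 2 ∂(shadowLaw T ρ) ≤ g.l1norm ^ 2 * c := by
  set d : Fin g.numTerms → Shadow κ T → ℝ := fun i s =>
    ∏ j, (ρ.expect (pauliString (g.string i j))).re - ∏ j, shadowEstimator (g.string i j) s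
  have hpt (s : Shadow κ T) :
      (g.eval ρ - g.shadowEval s) ^ 2 ≤ g.l1norm * ∑ i, |g.coeff i| * d i s ^ 2 := by
    have e : g.eval ρ - g.shadowEval s = ∑ i, g.coeff i * d i s := by
      simp only [StatePoly.eval, StatePoly.shadowEval, d, mul_sub, Finset.sum_sub_distrib]
    rw [e]
    refine Finset.sum_sq_le_sum_mul_sum_of_sq_le_mul _ (fun i _ => abs_nonneg _)
      (fun i _ => by positivity) fun i _ => ?_
    rw [mul_pow, ← sq_abs (g.coeff i), ← mul_assoc, sq]
  refine (integral_mono Integrable.of_finite Integrable.of_finite hpt).trans ?_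
  rw [integral_const_mul, integral_finsetSum _ fun _ _ => Integrable.of_finite]
  simp only [integral_const_mul]
  have h0 : 0 ≤ g.l1norm := Finset.sum_nonneg fun _ _ => abs_nonneg _
  calc g.l1norm * ∑ i, |g.coeff i| * ∫ s, d i s ^ 2 ∂(shadowLaw T ρ)
      ≤ g.l1norm * ∑ i, |g.coeff i| * c := by
        gcongr with i
        exact hc i
    _ = g.l1norm ^ 2 * c := by rw [← Finset.sum_mul, ← StatePoly.l1norm]; ring

end SecondMoment

/-! ### From bounds for each state to bounds under the data law. -/

section DataLaw

variable {κ : Type*} [Fintype κ] [DecidableEq κ] {T p : ℕ}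

lemma ae_dataLaw_abs_le (g : StatePoly κ p) (μ : Measure (QState κ)) :
    ∀ᵐ z ∂(dataLaw T g μ), |z.2| ≤ g.l1norm := by
  have hm : MeasurableSet {z : Shadow κ T × ℝ | |z.2| ≤ g.l1norm} :=
    measurableSet_le (measurable_snd.abs) measurable_const
  rw [ae_iff, ← Set.compl_ofPred, dataLaw, Measure.bind_apply hm.compl
    (measurable_sampleLaw T g).aemeasurable]
  refine (lintegral_congr fun ρ => ?_).trans lintegral_zero
  rw [Measure.map_apply (measurable_of_finite _) hm.compl]
  have : (fun s : Shadow κ T => (s, g.eval ρ)) ⁻¹' {z | |z.2| ≤ g.l1norm}ᶜ = ∅ := by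
    ext s
    simp [g.abs_eval_le ρ]
  rw [this, measure_empty]

/-- The data law is a mixture over states; nonnegativity of the loss permits conditioning on `ρ`
with lower integrals. -/
lemma expectedLoss_dataLaw_le {H : Type*} [NormedAddCommGroup H] [InnerProductSpace ℝ H]
    (φ : Shadow κ T → H) (g : StatePoly κ p) (μ : Measure (QState κ)) [IsProbabilityMeasure μ]
    {w : H} {c : ℝ} (hc : 0 ≤ c)
    (h : ∀ ρ, ∫ s, sqLoss φ w (s, g.eval ρ) ∂(shadowLaw T ρ) ≤ c) :
    expectedLoss φ (dataLaw T g μ) w ≤ c := by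
  have hm : Measurable (sqLoss φ w) := measurable_sqLoss φ w
  rw [expectedLoss, integral_eq_lintegral_of_nonneg_ae
    (ae_of_all _ fun z => sqLoss_nonneg φ w z) hm.aestronglyMeasurable]
  refine ENNReal.toReal_le_of_le_ofReal hc ?_
  rw [dataLaw, Measure.lintegral_bind (measurable_sampleLaw T g).aemeasurable
    hm.ennreal_ofReal.aemeasurable]
  refine (lintegral_mono (g := fun _ => ENNReal.ofReal c) fun ρ => ?_).trans (by simp)
  rw [lintegral_map hm.ennreal_ofReal (measurable_of_finite _),
    ← ofReal_integral_eq_lintegral_ofReal Integrable.of_finite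
      (ae_of_all _ fun s => sqLoss_nonneg φ w _)]
  exact ENNReal.ofReal_le_ofReal (h ρ)

end DataLaw

/-! ### The competitor in feature space and the norm of the features. -/

section Weights

variable {κ : Type*} [Fintype κ] [DecidableEq κ] {T : ℕ}

/-- The block index of a Pauli string: its support, and its letters there. -/
def supportBlock (P : κ → Fin 4) : BlockIndex κ :=
  ⟨pauliWeight P, fun l => ((Finset.univ.filter fun k => P k ≠ 0).equivFin.symm l : κ),
    fun l => P ((Finset.univ.filter fun k => P k ≠ 0).equivFin.symm l : κ)⟩

/-- Local shadows have trace `1`, so qubits with the identity letter drop out and the block on the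
support carries the full estimator. -/
lemma blockFeature_supportBlock (γ : ℝ) (s : Shadow κ T) (P : κ → Fin 4) :
    blockFeature γ s (supportBlock P) =
      √(1 / ((pauliWeight P).factorial : ℝ) * (γ / (Fintype.card κ : ℝ)) ^ pauliWeight P) /
        √(2 ^ pauliWeight P) * shadowEstimator P s := by
  have h (t : Fin T) : ∏ l, (pauli ((supportBlock P).2.2 l) *
      localShadow (s t ((supportBlock P).2.1 l))).trace.re = shotEstimator P (s t) := by
    refine (Equiv.prod_comp (Finset.univ.filter fun k => P k ≠ 0).equivFin.symm
      fun k => (pauli (P k) * localShadow (s t k)).trace.re).trans ?_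
    rw [Finset.prod_coe_sort _ fun k => (pauli (P k) * localShadow (s t k)).trace.re, shotEstimator]
    refine Finset.prod_subset (Finset.subset_univ _) fun k _ hk => ?_
    rw [show P k = 0 by simpa using hk, trace_pauli_zero_localShadow]
  rw [blockFeature, trace_pauliString_reducedShadow_re]
  simp only [h]
  rw [shadowEstimator, supportBlock]
  ring

/-- The component of the feature vector proportional to a product of shadow estimators. -/
def productIndex {p : ℕ} (P : Fin p → κ → Fin 4) : FeatureIndex κ :=
  ⟨p, fun j => supportBlock (P j)⟩

/-- The proportionality constant of that component. -/
def productScale {p : ℕ} (τ γ : ℝ) (P : Fin p → κ → Fin 4) : ℝ :=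
  √(τ ^ p / (p.factorial : ℝ)) * ∏ j,
    (√(1 / ((pauliWeight (P j)).factorial : ℝ) *
      (γ / (Fintype.card κ : ℝ)) ^ pauliWeight (P j)) / √(2 ^ pauliWeight (P j)))

lemma feature_productIndex {p : ℕ} (τ γ : ℝ) (s : Shadow κ T) (P : Fin p → κ → Fin 4) :
    feature τ γ s (productIndex P) = productScale τ γ P * ∏ j, shadowEstimator (P j) s := by
  simp only [feature, productIndex, productScale, blockFeature_supportBlock,
    Finset.prod_mul_distrib, mul_assoc]
  rfl

lemma productScale_sq {p : ℕ} {τ γ : ℝ} (hτ : 0 ≤ τ) (hγ : 0 ≤ γ) (P : Fin p → κ → Fin 4) :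
    productScale τ γ P ^ 2 = τ ^ p / p.factorial * ∏ j,
      ((pauliWeight (P j)).factorial * (2 * Fintype.card κ / γ) ^ pauliWeight (P j) : ℝ)⁻¹ := by
  rw [productScale, mul_pow, Real.sq_sqrt (by positivity), ← Finset.prod_pow]
  congr 1
  refine Finset.prod_congr rfl fun j _ => ?_
  rw [div_pow, Real.sq_sqrt (by positivity), Real.sq_sqrt (by positivity), mul_inv, ← inv_pow,
    inv_div, div_pow, div_pow, mul_pow]
  field_simp

/-- The weight vector whose prediction is the shadow estimate of `g`. -/
def StatePoly.weight {p : ℕ} (τ γ : ℝ) (g : StatePoly κ p) : FeatureSpace κ :=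
  open Classical in
  ∑ i, (g.coeff i * (productScale τ γ (g.string i))⁻¹) •
    lp.single 2 (productIndex (g.string i)) (1 : ℝ)

lemma inner_weight {p : ℕ} {τ γ : ℝ} (hτ : 0 < τ) (hγ : 0 < γ) (g : StatePoly κ p)
    (h : ∀ i, productScale τ γ (g.string i) ≠ 0) (s : Shadow κ T) :
    inner ℝ (g.weight τ γ) (featureMap hτ hγ s) = g.shadowEval s := by
  classical
  rw [StatePoly.weight, sum_inner, StatePoly.shadowEval]
  refine Finset.sum_congr rfl fun i _ => ?_
  rw [real_inner_smul_left]
  rw [lp.inner_single_left]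
  have : featureMap hτ hγ s (productIndex (g.string i)) =
    feature τ γ s (productIndex (g.string i)) := rfl
  rw [this, feature_productIndex]
  rw [show ∀ a : ℝ, inner ℝ (1 : ℝ) a = a by simp, mul_assoc, inv_mul_cancel_left₀ (h i)]

/-- The triangle inequality is enough, and it allows different terms of `g` to share a coordinate.
-/
lemma norm_weight_le {p : ℕ} {τ γ : ℝ} (g : StatePoly κ p) {C : ℝ}
    (h : ∀ i, |(productScale τ γ (g.string i))⁻¹| ≤ C) :
    ‖g.weight τ γ‖ ≤ g.l1norm * C := by
  classical
  rw [StatePoly.weight, StatePoly.l1norm, Finset.sum_mul]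
  refine norm_sum_le_of_le _ fun i _ => ?_
  rw [norm_smul, lp.norm_single (by norm_num), norm_one, mul_one, Real.norm_eq_abs, abs_mul]
  exact mul_le_mul_of_nonneg_left (h i) (abs_nonneg _)

/-- In the Pauli basis the identity contributes `1/2` and the measured letter of `x` at most `9/2`.
-/
lemma trace_localShadow_mul_re_le (x y : Fin 3 × Fin 2) :
    (localShadow x * localShadow y).trace.re ≤ 5 := by
  rw [← localShadow_inner]
  have h (P : Fin 4) : (pauli P * localShadow x).trace.re * (pauli P * localShadow y).trace.re / 2 ≤
      if P = 0 then 1 / 2 else if P = x.1.succ then 9 / 2 else 0 := by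
    have hy := abs_trace_pauli_localShadow_le P y
    have hx := abs_trace_pauli_localShadow_le P x
    split_ifs with h0 h1
    · subst h0
      simp [trace_pauli_zero_localShadow]
    · rw [if_pos h0] at hx hy
      have := (le_abs_self _).trans ((abs_mul _ _).le.trans (mul_le_mul hx hy (abs_nonneg _)
        (by norm_num)))
      linarith
    · rw [trace_pauli_localShadow P x]
      simp [h0, h1]
  refine (Finset.sum_le_sum fun P _ => h P).trans ?_
  rw [Fin.sum_univ_succ]
  simp [Fin.succ_ne_zero]
  norm_num

/-- The squared norm is the kernel on the diagonal, and its inner double sum averages terms of size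
at most `exp (5 * γ)`. Bounding `x⁻¹ * x` by `1` also covers `T = 0` and an empty set of qubits. -/
lemma norm_featureMap_le {τ γ : ℝ} (hτ : 0 < τ) (hγ : 0 < γ) (s : Shadow κ T) :
    ‖featureMap hτ hγ s‖ ≤ √(Real.exp (τ * Real.exp (5 * γ))) := by
  refine Real.le_sqrt_of_sq_le ?_
  rw [← real_inner_self_eq_norm_sq, inner_featureMap, shadowKernel, Real.exp_le_exp]
  have h1 (t t' : Fin T) : γ / (Fintype.card κ : ℝ) *
      ∑ k, (localShadow (s t k) * localShadow (s t' k)).trace.re ≤ 5 * γ := by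
    have h : ∑ k, (localShadow (s t k) * localShadow (s t' k)).trace.re ≤ Fintype.card κ * 5 :=
      (Finset.sum_le_sum fun k _ => trace_localShadow_mul_re_le _ _).trans (by simp)
    refine (mul_le_mul_of_nonneg_left h (by positivity)).trans ?_
    rw [show γ / (Fintype.card κ : ℝ) * (Fintype.card κ * 5) =
      5 * γ * ((Fintype.card κ : ℝ)⁻¹ * Fintype.card κ) by ring]
    exact mul_le_of_le_one_right (by positivity) inv_mul_le_one
  have h2 : ∑ t, ∑ t', Real.exp (γ / (Fintype.card κ : ℝ) *
      ∑ k, (localShadow (s t k) * localShadow (s t' k)).trace.re) ≤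
      (T : ℝ) ^ 2 * Real.exp (5 * γ) := by
    refine (Finset.sum_le_sum fun t _ => Finset.sum_le_sum fun t' _ =>
      Real.exp_le_exp.2 (h1 t t')).trans (le_of_eq ?_)
    simp only [Finset.sum_const, Finset.card_univ, Fintype.card_fin, nsmul_eq_mul]
    ring
  refine (mul_le_mul_of_nonneg_left h2 (by positivity)).trans ?_
  rw [show τ / (T : ℝ) ^ 2 * ((T : ℝ) ^ 2 * Real.exp (5 * γ)) =
    τ * Real.exp (5 * γ) * (((T : ℝ) ^ 2)⁻¹ * (T : ℝ) ^ 2) by ring]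
  exact mul_le_of_le_one_right (by positivity) inv_mul_le_one

end Weights

/-! ### Numerical choice of the parameters. -/

section Parameters

variable {κ : Type*} [Fintype κ] [DecidableEq κ] {T : ℕ}

lemma productScale_pos {p : ℕ} {τ γ : ℝ} (hτ : 0 < τ) (hγ : 0 < γ)
    (hn : 0 < Fintype.card κ) (P : Fin p → κ → Fin 4) : 0 < productScale τ γ P := by
  have : (0 : ℝ) < Fintype.card κ := Nat.cast_pos.2 hn
  exact mul_pos (by positivity) (Finset.prod_pos fun j _ => by positivity)

/-- Factorials are replaced by powers. The assumptions `1 ≤ 2 n / γ` and `1 ≤ m p / τ` are what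
permits raising the exponents to `m` and `m * p`. -/
lemma abs_inv_productScale_le {m p : ℕ} {τ γ : ℝ} (hτ : 0 < τ) (hγ : 0 < γ)
    (hm : 1 ≤ m) (hp : 1 ≤ p) (hnγ : 1 ≤ 2 * (Fintype.card κ : ℝ) / γ)
    (hmpτ : 1 ≤ (m : ℝ) * p / τ) {P : Fin p → κ → Fin 4} (hP : ∀ j, pauliWeight (P j) ≤ m) :
    |(productScale τ γ P)⁻¹| ≤
      √((2 * (m : ℝ) ^ 2 * (p : ℝ) ^ 2 / (τ * γ)) ^ (m * p) * (Fintype.card κ : ℝ) ^ (m * p)) := by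
  refine Real.abs_le_sqrt ?_
  rw [inv_pow, productScale_sq hτ.le hγ.le, mul_inv, inv_div, ← Finset.prod_inv_distrib]
  simp only [inv_inv]
  set ν : ℝ := 2 * (Fintype.card κ : ℝ) / γ with hν
  have hm' : (1 : ℝ) ≤ m := Nat.one_le_cast.2 hm
  have hp' : (1 : ℝ) ≤ p := Nat.one_le_cast.2 hp
  have h1 : ∏ j, ((pauliWeight (P j)).factorial * ν ^ pauliWeight (P j) : ℝ) ≤
      ((m : ℝ) ^ m * ν ^ m) ^ p := by
    refine (Finset.prod_le_prod (fun j _ => by positivity)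
      fun j _ => mul_le_mul (b := (m : ℝ) ^ m) (d := ν ^ m) ?_
        (pow_le_pow_right₀ hnγ (hP j)) (by positivity) (by positivity)).trans (by simp)
    exact_mod_cast (Nat.factorial_le (hP j)).trans (Nat.factorial_le_pow m)
  have h2 : (p.factorial : ℝ) / τ ^ p ≤ ((m : ℝ) * p / τ) ^ (m * p) := by
    calc (p.factorial : ℝ) / τ ^ p ≤ (p : ℝ) ^ p / τ ^ p := by
          gcongr
          exact_mod_cast Nat.factorial_le_pow p
      _ = (1 * p / τ) ^ p := by rw [one_mul, div_pow]
      _ ≤ ((m : ℝ) * p / τ) ^ p := by gcongr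
      _ ≤ ((m : ℝ) * p / τ) ^ (m * p) := pow_le_pow_right₀ hmpτ (Nat.le_mul_of_pos_left p hm)
  calc (p.factorial : ℝ) / τ ^ p *
        ∏ j, ((pauliWeight (P j)).factorial * ν ^ pauliWeight (P j) : ℝ)
      ≤ ((m : ℝ) * p / τ) ^ (m * p) * ((m : ℝ) ^ m * ν ^ m) ^ p :=
        mul_le_mul h2 h1 (Finset.prod_nonneg fun j _ => by positivity) (by positivity)
    _ = ((m : ℝ) * p / τ) ^ (m * p) * ((m * 1 * ν) ^ (m * p)) := by
        rw [← mul_pow, ← pow_mul, mul_one]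
    _ ≤ ((m : ℝ) * p / τ) ^ (m * p) * ((m * p * ν) ^ (m * p)) := by gcongr
    _ = _ := by
        rw [← mul_pow, ← mul_pow, hν]
        congr 1
        field_simp

lemma exp_sub_one_le {x : ℝ} (h0 : 0 ≤ x) (h1 : x ≤ 1 / 2) : Real.exp x - 1 ≤ 3 / 2 * x := by
  have h := (abs_le.1 (Real.abs_exp_sub_one_sub_id_le (x := x)
    (abs_le.2 ⟨by linarith, by linarith⟩))).2
  nlinarith

/-- The mean square error of the shadow estimate of a polynomial, for sufficiently many shots. -/
lemma error_bound {m p : ℕ} (hm : 1 ≤ m) (hp : 1 ≤ p) {ε G : ℝ} (hε : 0 < ε) (hεG : ε < G)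
    (hT : 256 / (3 * ε ^ 2) * G ^ 2 * 12 ^ m * ((m : ℝ) * p) ^ 2 *
      Real.log (G ^ 2 * 2 ^ (m + 5) * ((m : ℝ) * p) * (3 ^ (m ^ 2 * p) + 1) ^ 2 / ε ^ 2) ≤ T) :
    0 < T ∧ ((1 + ε / (2 * p * G)) ^ p - 1) ^ 2 + (3 ^ (m * p) + 1) ^ 2 *
      (p * (2 * Real.exp (-(T * (ε / (2 * p * G)) ^ 2 / (2 * 9 ^ m))))) ≤
        5 / 8 * (ε / G) ^ 2 := by
  have hG : 0 < G := hε.trans hεG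
  have hm' : (1 : ℝ) ≤ m := Nat.one_le_cast.2 hm
  have hp' : (1 : ℝ) ≤ p := Nat.one_le_cast.2 hp
  set δ := ε / G with hδ
  have hδ0 : 0 < δ := div_pos hε hG
  have hδ1 : δ < 1 := (div_lt_one hG).2 hεG
  set M := G ^ 2 * 2 ^ (m + 5) * ((m : ℝ) * p) * (3 ^ (m ^ 2 * p) + 1) ^ 2 / ε ^ 2 with hM
  have hMδ : M = 2 ^ (m + 5) * ((m : ℝ) * p) * (3 ^ (m ^ 2 * p) + 1) ^ 2 / δ ^ 2 := by
    rw [hM, hδ]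
    field_simp
  have hM1 : 1 < M := by
    rw [hMδ, lt_div_iff₀ (by positivity), one_mul]
    have a1 : (1 : ℝ) ≤ 2 ^ (m + 5) := one_le_pow₀ (by norm_num)
    have a2 : (1 : ℝ) ≤ m * p := one_le_mul_of_one_le_of_one_le hm' hp'
    have a3 : (1 : ℝ) ≤ (3 ^ (m ^ 2 * p) + 1) ^ 2 :=
      one_le_pow₀ (le_add_of_nonneg_left (by positivity))
    have := one_le_mul_of_one_le_of_one_le (one_le_mul_of_one_le_of_one_le a1 a2) a3
    have : δ ^ 2 < 1 := pow_lt_one₀ hδ0.le hδ1 two_ne_zero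
    linarith
  have hlog : 0 < Real.log M := Real.log_pos hM1
  have hTpos : (0 : ℝ) < T := lt_of_lt_of_le (by positivity) hT
  refine ⟨Nat.cast_pos.1 hTpos, ?_⟩
  have hη : ε / (2 * p * G) = δ / (2 * p) := by
    rw [hδ]
    field_simp
  rw [hη]
  -- The target `5/8` splits as `9/16 + 1/16`: the square of this bound for accurate estimates, and
  -- `c3` for the bad events.
  have b1 : (1 + δ / (2 * p)) ^ p - 1 ≤ 3 / 4 * δ := by
    have e1 : (1 + δ / (2 * p)) ^ p ≤ Real.exp (δ / 2) := by
      calc (1 + δ / (2 * p)) ^ p ≤ Real.exp (δ / (2 * p)) ^ p := by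
            gcongr
            rw [add_comm]
            exact Real.add_one_le_exp _
        _ = Real.exp (δ / 2) := by
            rw [← Real.exp_nat_mul]
            congr 1
            field_simp
    have e2 := exp_sub_one_le (x := δ / 2) (by positivity) (by linarith)
    linarith
  have b0 : 0 ≤ (1 + δ / (2 * p)) ^ p - 1 :=
    sub_nonneg.2 (one_le_pow₀ (le_add_of_nonneg_right (by positivity)))
  have b2 : ((1 + δ / (2 * p)) ^ p - 1) ^ 2 ≤ 9 / 16 * δ ^ 2 :=
    (pow_le_pow_left₀ b0 b1 2).trans (le_of_eq (by ring))
  -- The lower bound on `T` is generous: only `2 * 9 ^ m` of `64/3 * 12 ^ m * m²` is needed.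
  have c1 : Real.log M ≤ T * (δ / (2 * p)) ^ 2 / (2 * 9 ^ m) := by
    rw [le_div_iff₀ (by positivity)]
    have hT' : 256 / (3 * δ ^ 2) * 12 ^ m * ((m : ℝ) * p) ^ 2 * Real.log M ≤ T := by
      refine le_of_eq_of_le ?_ hT
      rw [hδ]
      field_simp
    refine le_trans ?_ (mul_le_mul_of_nonneg_right hT' (by positivity))
    have e : 256 / (3 * δ ^ 2) * 12 ^ m * ((m : ℝ) * p) ^ 2 * Real.log M * (δ / (2 * p)) ^ 2 =
        64 / 3 * 12 ^ m * (m : ℝ) ^ 2 * Real.log M := by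
      field_simp
      ring
    rw [e]
    have f1 : (9 : ℝ) ^ m ≤ 12 ^ m := by gcongr; norm_num
    have f2 : (1 : ℝ) ≤ (m : ℝ) ^ 2 := one_le_pow₀ hm'
    calc Real.log M * (2 * 9 ^ m) ≤ Real.log M * (2 * 12 ^ m) := by gcongr
      _ = 2 * 12 ^ m * 1 * Real.log M := by ring
      _ ≤ 64 / 3 * 12 ^ m * (m : ℝ) ^ 2 * Real.log M := by
        gcongr
        norm_num
  have c2 : Real.exp (-(T * (δ / (2 * p)) ^ 2 / (2 * 9 ^ m))) ≤ M⁻¹ := by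
    rw [← Real.exp_log (inv_pos.2 (zero_lt_one.trans hM1)), Real.log_inv, Real.exp_le_exp]
    exact neg_le_neg c1
  have c3 : (3 ^ (m * p) + 1) ^ 2 *
      (p * (2 * Real.exp (-(T * (δ / (2 * p)) ^ 2 / (2 * 9 ^ m))))) ≤ 1 / 16 * δ ^ 2 := by
    have g1 : (3 : ℝ) ^ (m * p) ≤ 3 ^ (m ^ 2 * p) :=
      pow_le_pow_right₀ (by norm_num)
        (Nat.mul_le_mul_right p (by rw [sq]; exact Nat.le_mul_of_pos_left m hm))
    have g2 : (1 : ℝ) ≤ 2 ^ m := one_le_pow₀ (by norm_num)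
    calc (3 ^ (m * p) + 1) ^ 2 * (p * (2 * Real.exp (-(T * (δ / (2 * p)) ^ 2 / (2 * 9 ^ m)))))
        ≤ (3 ^ (m ^ 2 * p) + 1) ^ 2 * (p * (2 * M⁻¹)) := by gcongr
      -- `M` was built to cancel the prefactor; `2 / 2 ^ 5` leaves `1/16`.
      _ = 1 / 16 * δ ^ 2 * ((2 : ℝ) ^ m * m)⁻¹ := by
          rw [hMδ, pow_add]
          field_simp
          norm_num
      _ ≤ 1 / 16 * δ ^ 2 := mul_le_of_le_one_right (by positivity)
          (inv_le_one_of_one_le₀ (one_le_mul_of_one_le_of_one_le g2 hm'))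
  linarith

lemma integral_sqLoss_weight_le {m p : ℕ} {τ γ : ℝ} (hτ : 0 < τ) (hγ : 0 < γ)
    (hn : 0 < Fintype.card κ) (g : StatePoly κ p) (hg : g.IsBody m)
    (hm : 1 ≤ m) (hp : 1 ≤ p) {ε : ℝ} (hε : 0 < ε) (hεg : ε < g.l1norm)
    (hT : 256 / (3 * ε ^ 2) * g.l1norm ^ 2 * 12 ^ m * ((m : ℝ) * p) ^ 2 *
      Real.log (g.l1norm ^ 2 * 2 ^ (m + 5) * ((m : ℝ) * p) * (3 ^ (m ^ 2 * p) + 1) ^ 2 / ε ^ 2) ≤ T)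
    (ρ : QState κ) :
    ∫ s : Shadow κ T, sqLoss (featureMap hτ hγ) (g.weight τ γ) (s, g.eval ρ) ∂(shadowLaw T ρ) ≤
      5 / 16 * ε ^ 2 := by
  have hG : 0 < g.l1norm := hε.trans hεg
  obtain ⟨hT0, hbound⟩ := error_bound hm hp hε hεg hT
  have h := integral_sq_eval_sub_shadowEval_le (T := T) g ρ fun i =>
    (integral_sq_prod_sub_prod_le ρ (hg i) hT0
      (show 0 ≤ ε / (2 * p * g.l1norm) by positivity)).trans hbound
  simp only [sqLoss, inner_weight hτ hγ g fun i => (productScale_pos hτ hγ hn _).ne']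
  rw [integral_div]
  have e : g.l1norm ^ 2 * (5 / 8 * (ε / g.l1norm) ^ 2) = 5 / 8 * ε ^ 2 := by field_simp
  linarith

end Parameters

end QShadow

end

/-! ### Assembly of the error budget. -/

theorem mainTheorem4
    {D : ℕ} (L : Fin D → ℕ) (n : ℕ) (hn : Fintype.card (Site L) = n)
    (m p : ℕ) (g : StatePoly (Site L) p) (hg : g.IsBody m)
    (ξ : ℝ) (hξ : 0 < ξ)
    (μ : Measure (QState (Site L))) [IsProbabilityMeasure μ]
    (hμ : ∀ᵐ ρ ∂μ, ClustersWithin latticeDist ξ ρ)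
    (τ γ : ℝ) (hτ : 0 < τ) (hγ : 0 < γ)
    (hnγ : 1 ≤ 2 * (n : ℝ) / γ) (hmpτ : 1 ≤ (m : ℝ) * p / τ)
    (ε : ℝ) (hε : 0 < ε) (hεg : ε < g.l1norm)
    (N T : ℕ)
    (hN : 600 / ε ^ 4 * g.l1norm ^ 4 * Real.exp (τ * Real.exp (5 * γ)) *
      (2 * (m : ℝ) ^ 2 * (p : ℝ) ^ 2 / (τ * γ)) ^ (m * p) * (n : ℝ) ^ (m * p) ≤ N)
    (hT : 256 / (3 * ε ^ 2) * g.l1norm ^ 2 * 12 ^ m * ((m : ℝ) * p) ^ 2 *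
      Real.log (g.l1norm ^ 2 * 2 ^ (m + 5) * ((m : ℝ) * p) * (3 ^ (m ^ 2 * p) + 1) ^ 2 / ε ^ 2) ≤ T)
    (Bsq lam : ℝ)
    (hBsq : Bsq = g.l1norm ^ 2 * (2 * (m : ℝ) ^ 2 * (p : ℝ) ^ 2 / (τ * γ)) ^ (m * p) *
      (n : ℝ) ^ (m * p))
    (hlam : lam = ε ^ 2 / (6 * Bsq)) :
    (∀ w : FeatureSpace (Site L),
      Integrable (sqLoss (featureMap hτ hγ) w) (dataLaw T g μ)) ∧
    (∀ Z : Fin N → Shadow (Site L) T × ℝ,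
      ∃! w, IsRidgeSolution (featureMap hτ hγ) lam Bsq Z w) ∧
    ∀ wstar : (Fin N → Shadow (Site L) T × ℝ) → FeatureSpace (Site L),
      (∀ Z, IsRidgeSolution (featureMap hτ hγ) lam Bsq Z (wstar Z)) →
      Integrable (fun Z => expectedLoss (featureMap hτ hγ) (dataLaw T g μ) (wstar Z))
        (Measure.pi fun _ : Fin N => dataLaw T g μ) ∧
      ∫ Z, expectedLoss (featureMap hτ hγ) (dataLaw T g μ) (wstar Z)
        ∂(Measure.pi fun _ : Fin N => dataLaw T g μ) ≤ ε ^ 2 := by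
  subst hn
  have hmp : 0 < (m : ℝ) * p := by
    by_contra hc
    have := div_nonpos_of_nonpos_of_nonneg (not_lt.1 hc) hτ.le
    linarith
  have hm : 1 ≤ m := Nat.one_le_iff_ne_zero.2 (by rintro rfl; simp at hmp)
  have hp : 1 ≤ p := Nat.one_le_iff_ne_zero.2 (by rintro rfl; simp at hmp)
  have hcard : 0 < Fintype.card (Site L) := by
    refine Nat.pos_of_ne_zero fun h0 => ?_
    rw [h0] at hnγ
    norm_num at hnγ
  have hcard' : (0 : ℝ) < Fintype.card (Site L) := Nat.cast_pos.2 hcard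
  have hm' : (0 : ℝ) < m := Nat.cast_pos.2 hm
  have hp' : (0 : ℝ) < p := Nat.cast_pos.2 hp
  have hG : 0 < g.l1norm := hε.trans hεg
  set Q : ℝ := (2 * (m : ℝ) ^ 2 * (p : ℝ) ^ 2 / (τ * γ)) ^ (m * p) *
    (Fintype.card (Site L) : ℝ) ^ (m * p) with hQ
  have hQ0 : 0 < Q := by positivity
  rw [mul_assoc, ← hQ] at hBsq hN
  have hB0 : 0 < Bsq := hBsq ▸ by positivity
  have hlam0 : 0 < lam := hlam ▸ by positivity
  set R : ℝ := √(Real.exp (τ * Real.exp (5 * γ)))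
  have hRsq : R ^ 2 = Real.exp (τ * Real.exp (5 * γ)) := Real.sq_sqrt (Real.exp_pos _).le
  have hR : ∀ s : Shadow (Site L) T, ‖featureMap hτ hγ s‖ ≤ R := norm_featureMap_le hτ hγ
  have hy := ae_dataLaw_abs_le (T := T) g μ
  have hN0 : (0 : ℝ) < N := lt_of_lt_of_le (by positivity) hN
  -- Here `100 = 600 / 6`, from the constants in `N` and `lam`; the factor `Q` cancels against
  -- `Bsq`.
  have hlamN : 100 * R ^ 2 * g.l1norm ^ 2 ≤ lam * N * ε ^ 2 := by
    rw [hRsq]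
    have := mul_le_mul_of_nonneg_left hN (show 0 ≤ lam * ε ^ 2 by positivity)
    refine le_of_eq_of_le ?_ (this.trans (le_of_eq (by ring)))
    rw [hlam, hBsq]
    field_simp
    norm_num
  refine ⟨integrable_sqLoss hR hy, existsUnique_isRidgeSolution _ hlam0 hB0.le, fun wstar hw =>
    ⟨integrable_expectedLoss_ridge hlam0 (Real.sqrt_nonneg _) hR hy hw, ?_⟩⟩
  have hwB : ‖g.weight τ γ‖ ^ 2 ≤ Bsq := by
    have h := norm_weight_le g fun i =>
      abs_inv_productScale_le hτ hγ hm hp hnγ hmpτ (hg i)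
    refine (pow_le_pow_left₀ (norm_nonneg _) h 2).trans (le_of_eq ?_)
    rw [mul_pow, Real.sq_sqrt hQ0.le, hBsq]
  have hεG : ε ^ 2 ≤ g.l1norm ^ 2 := pow_le_pow_left₀ hε.le hεg.le 2
  have hκ : 2 * R ^ 2 ≤ lam * N := by
    have h1 : 100 * R ^ 2 * ε ^ 2 ≤ lam * N * ε ^ 2 :=
      (mul_le_mul_of_nonneg_left hεG (by positivity)).trans hlamN
    have := le_of_mul_le_mul_right h1 (by positivity)
    linarith [sq_nonneg R]
  refine (integral_expectedLoss_ridge_le hlam0 (Nat.cast_pos.1 hN0) (Real.sqrt_nonneg _) hR hy hw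
    hwB hκ).trans ?_
  have hloss : expectedLoss (featureMap hτ hγ) (dataLaw T g μ) (g.weight τ γ) ≤ 5 / 16 * ε ^ 2 :=
    expectedLoss_dataLaw_le _ g μ (by positivity)
      (integral_sqLoss_weight_le hτ hγ hcard g hg hm hp hε hεg hT)
  have hreg : lam * Bsq = ε ^ 2 / 6 := by
    rw [hlam]
    field_simp
  have hstab : R ^ 2 / (lam * N) * g.l1norm ^ 2 ≤ ε ^ 2 / 100 := by
    rw [div_mul_eq_mul_div, div_le_iff₀ (by positivity)]
    linarith
  have : 0 < ε ^ 2 := by positivity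
  -- The budget is `5/16` for sampling error, `1/6` for regularisation and `2/100` for stability, in
  -- units of `ε²`; the sum is below `1`.
  linarith
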